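/- Let $m\in(1,\infty)$ and $$\Phi(r)=\frac{1}{m(m+1)}\Big(\frac1{(1-r)^m}-m\,r-1\Big)\qquad(r<1).$$ Let $(V_\delta,R_\delta,\sigma_\delta)_{0<\delta<1}$ be a family of solitary waves such that, for every $\delta$: $\sigma_\delta>0$ and $$R_\delta'(x)=V_\delta(x+\tfrac12)-V_\delta(x-\tfrac12),\qquad \sigma_\delta V_\delta'(x)=\Phi'\big(R_\delta(x+\tfrac12)\big)-\Phi'\big(R_\delta(x-\tfrac12)\big)\qquad(x\in\mathbb R);$$ $V_\delta$ and $R_\delta$ belong to $L^2(\mathbb R)\cap BC^1(\mathbb R)$ (where $BC^1$ means $C^1$, bounded, with bounded derivative) and are nonnegative, even and unimodal (increasing on $(-\infty,0]$ and decreasing on $[0,\infty)$); $\|V_\delta\|_2=1-\delta$; $R_\delta$ takes values in $[0,1)$. Assume moreover that $\int_{\mathbb R}\Phi(R_\delta(x))\,dx\to+\infty$ as $\delta\to0$. Put $\varepsilon_\delta:=1-R_\delta(0)$. The initial value problem $$\tilde S_0''(\tilde x)=\frac{2}{m+1}\cdot\frac1{(1+\tilde S_0(\tilde x))^{m+1}},\qquad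 \tilde S_0(0)=\tilde S_0'(0)=0$$ has a unique global solution $\tilde S_0:\mathbb R\to(-1,\infty)$, and the integral $$\bar\kappa:=\int_0^\infty \tilde x\,\tilde S_0''(\tilde x)\,d\tilde x$$ converges absolutely. Put $$\bar\mu:=\frac{2}{\sqrt{m(m+1)}},\qquad \tilde W_0(\tilde x):=\tfrac12\big(\tilde S_0'(\tilde x)+\bar\mu\big),\qquad \tilde T_0(\tilde x):=\tfrac12\big(\tilde S_0(\tilde x)+\bar\mu\,\tilde x+\bar\kappa\big),$$ $$\hat\mu_\varepsilon:=\frac{\bar\mu\,\varepsilon}{1+\varepsilon(\bar\kappa-1)},\qquad \hat\sigma_\varepsilon:=\varepsilon^{-m-2}\hat\mu_\varepsilon^2,$$ $$\hat R_\varepsilon(x):=\begin{cases}1-\varepsilon-\varepsilon\,\tilde S_0\big(|x|/\hat\mu_\varepsilon\big)&\text{for }0\le|x|<\tfrac12,\\ \varepsilon\,\tilde T_0\big((1-|x|)/\hat\mu_\varepsilon\big)&\text{for }\tfrac12\le|x|<\tfrac32,\\ 0&\text{else,}\end{cases}$$ $$\hat V_\varepsilon(x):=\frac{\varepsilon}{\hat\mu_\varepsilon}\begin{cases}\tilde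 W_0\big((\tfrac12-|x|)/\hat\mu_\varepsilon\big)&\text{for }0\le|x|<1,\\ 0&\text{else.}\end{cases}$$ Then, as $\delta\to0$, $$\|R_\delta-\hat R_{\varepsilon_\delta}\|_q+\|V_\delta-\hat V_{\varepsilon_\delta}\|_q+\varepsilon_\delta^m\,|\sigma_\delta-\hat\sigma_{\varepsilon_\delta}|=O(\varepsilon_\delta^m)=O(\delta^m)$$ for every $q\in[1,\infty]$, with constants independent of $q$ and $\delta$. Here $\varepsilon_\delta^m$ and $\delta^m$ are of the same order as $\delta\to0$, that is, each is bounded by a constant multiple of the other for all sufficiently small $\delta>0$. -/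

import Mathlib

open Real Set Filter Topology MeasureTheory Asymptotics
open scoped ENNReal

namespace FPU

noncomputable section

/-- The interaction potential `Φ(r) = ((1 - r)^(-m) - m r - 1) / (m (m + 1))`, used for `r < 1`. -/
def potential (m r : ℝ) : ℝ :=
  1 / (m * (m + 1)) * (1 / (1 - r) ^ m - m * r - 1)

/-- `f` belongs to `BC¹(ℝ)`: it is continuously differentiable, and `f` and `f'` are bounded. -/
structure IsBC1 (f : ℝ → ℝ) : Prop where
  contDiff : ContDiff ℝ 1 f
  bounded : ∃ C, ∀ x, |f x| ≤ C
  deriv_bounded : ∃ C, ∀ x, |deriv f x| ≤ C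

/-- A unimodal profile is increasing for negative and decreasing for positive arguments. -/
structure IsUnimodal (f : ℝ → ℝ) : Prop where
  monotoneOn : MonotoneOn f (Iic 0)
  antitoneOn : AntitoneOn f (Ici 0)

/-- `(V, R, σ)` solves the travelling wave equations
`R'(x) = V(x + 1/2) - V(x - 1/2)` and `σ V'(x) = Φ'(R(x + 1/2)) - Φ'(R(x - 1/2))`
with a positive speed parameter `σ`. -/
structure IsTravellingWave (m : ℝ) (V R : ℝ → ℝ) (σ : ℝ) : Prop where
  speed_pos : 0 < σ
  diff_R : Differentiable ℝ R
  diff_V : Differentiable ℝ V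
  eq_R : ∀ x, deriv R x = V (x + 1 / 2) - V (x - 1 / 2)
  eq_V : ∀ x, σ * deriv V x =
    deriv (potential m) (R (x + 1 / 2)) - deriv (potential m) (R (x - 1 / 2))

/-- A family `(V δ, R δ, σ δ)`, `0 < δ < 1`, of high-energy solitary waves. -/
structure IsHighEnergyFamily (m : ℝ) (V R : ℝ → ℝ → ℝ) (σ : ℝ → ℝ) : Prop where
  wave : ∀ δ ∈ Ioo (0 : ℝ) 1, IsTravellingWave m (V δ) (R δ) (σ δ)
  memLp_V : ∀ δ ∈ Ioo (0 : ℝ) 1, MemLp (V δ) 2 volume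
  memLp_R : ∀ δ ∈ Ioo (0 : ℝ) 1, MemLp (R δ) 2 volume
  bc1_V : ∀ δ ∈ Ioo (0 : ℝ) 1, IsBC1 (V δ)
  bc1_R : ∀ δ ∈ Ioo (0 : ℝ) 1, IsBC1 (R δ)
  nonneg_V : ∀ δ ∈ Ioo (0 : ℝ) 1, ∀ x, 0 ≤ V δ x
  even_V : ∀ δ ∈ Ioo (0 : ℝ) 1, ∀ x, V δ (-x) = V δ x
  even_R : ∀ δ ∈ Ioo (0 : ℝ) 1, ∀ x, R δ (-x) = R δ x
  unimodal_V : ∀ δ ∈ Ioo (0 : ℝ) 1, IsUnimodal (V δ)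
  unimodal_R : ∀ δ ∈ Ioo (0 : ℝ) 1, IsUnimodal (R δ)
  norm_V : ∀ δ ∈ Ioo (0 : ℝ) 1, eLpNorm (V δ) 2 volume = ENNReal.ofReal (1 - δ)
  range_R : ∀ δ ∈ Ioo (0 : ℝ) 1, ∀ x, R δ x ∈ Ico (0 : ℝ) 1
  energy_tendsto : Tendsto (fun δ => ∫ x, potential m (R δ x)) (𝓝[>] 0) atTop

/-- The amplitude parameter `ε_δ = 1 - R_δ(0)`. -/
def amplitude (R : ℝ → ℝ → ℝ) (δ : ℝ) : ℝ := 1 - R δ 0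

/-- `S` is a global solution of `S'' = 2 / (m + 1) * (1 + S)^(-(m + 1))`, `S(0) = S'(0) = 0`,
with values in the domain `S > -1` of the right hand side. -/
structure IsTipProfile (m : ℝ) (S : ℝ → ℝ) : Prop where
  init : S 0 = 0
  init_deriv : deriv S 0 = 0
  gt_neg_one : ∀ x, -1 < S x
  differentiable : Differentiable ℝ S
  ode : ∀ x, HasDerivAt (deriv S) (2 / (m + 1) * (1 / (1 + S x) ^ (m + 1))) x

/-- `μ̄ = 2 / √(m (m + 1))`. -/
def muBar (m : ℝ) : ℝ := 2 / √(m * (m + 1))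

/-- `κ̄ = ∫₀^∞ x S''(x) dx`. -/
def kappaBar (S : ℝ → ℝ) : ℝ := ∫ x in Ioi (0 : ℝ), x * deriv (deriv S) x

/-- `W₀(x) = (S'(x) + μ̄) / 2`, the limit profile of the transition scaling. -/
def transitionProfile (m : ℝ) (S : ℝ → ℝ) (x : ℝ) : ℝ := 1 / 2 * (deriv S x + muBar m)

/-- `T₀(x) = (S(x) + μ̄ x + κ̄) / 2`, the limit profile of the foot scaling. -/
def footProfile (m : ℝ) (S : ℝ → ℝ) (x : ℝ) : ℝ := 1 / 2 * (S x + muBar m * x + kappaBar S)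

/-- `μ̂_ε = μ̄ ε / (1 + ε (κ̄ - 1))`. -/
def muHat (m : ℝ) (S : ℝ → ℝ) (ε : ℝ) : ℝ := muBar m * ε / (1 + ε * (kappaBar S - 1))

/-- `σ̂_ε = ε^(-m-2) μ̂_ε²`. -/
def sigmaHat (m : ℝ) (S : ℝ → ℝ) (ε : ℝ) : ℝ := ε ^ (-m - 2) * muHat m S ε ^ 2

/-- The approximate distance profile `R̂_ε`. -/
def RHat (m : ℝ) (S : ℝ → ℝ) (ε x : ℝ) : ℝ :=
  if |x| < 1 / 2 then 1 - ε - ε * S (|x| / muHat m S ε)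
  else if |x| < 3 / 2 then ε * footProfile m S ((1 - |x|) / muHat m S ε)
  else 0

/-- The approximate velocity profile `V̂_ε`. -/
def VHat (m : ℝ) (S : ℝ → ℝ) (ε x : ℝ) : ℝ :=
  ε / muHat m S ε *
    (if |x| < 1 then transitionProfile m S ((1 / 2 - |x|) / muHat m S ε) else 0)

/-- The total error `‖R_δ - R̂_ε‖_q + ‖V_δ - V̂_ε‖_q + ε^m |σ_δ - σ̂_ε|` at `ε = ε_δ`, as an
extended nonnegative number. -/
def approxError (m : ℝ) (S : ℝ → ℝ) (V R : ℝ → ℝ → ℝ) (σ : ℝ → ℝ) (q : ℝ≥0∞) (δ : ℝ) : ℝ≥0∞ :=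
  eLpNorm (fun x => R δ x - RHat m S (amplitude R δ) x) q volume
    + eLpNorm (fun x => V δ x - VHat m S (amplitude R δ) x) q volume
    + ENNReal.ofReal (amplitude R δ ^ m * |σ δ - sigmaHat m S (amplitude R δ)|)

end

end FPU

/-!
Near its maximum the distance profile `R` is governed by an ordinary differential equation. If the
force is written `Φ'(r) = ((1 - r) ^ (-(m + 1)) - 1) / (m + 1)`, the travelling wave equations give
`σ R''(x) = Φ'(R(x + 1)) + Φ'(R(x - 1)) - 2 Φ'(R(x))`, and for `|x| ≤ 1 / 2` the first two forces
stay bounded because `R(± 1 / 2)` is close to `1 / 2`. With `ε = 1 - R(0)` and `μ² = σ ε ^ (m + 2)`,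
the function `S(x) = (1 - ε - R(μ x)) / ε` therefore solves the tip equation up to an error
`O(ε ^ (m + 1))` on `|x| ≤ 1 / (2 μ)` (`SolitaryWave.scaled_tip_equation`). Since `S` is convex it
grows linearly, so the linearised force decays like `x ^ (-3)` and a weighted Gronwall estimate
(`abs_le_of_abs_second_deriv_le`) shows that the error is not amplified: `S' - S₀' = O(ε ^ m)` and
`S - S₀ = O(ε ^ (m - 1))` (`IsTipProfile.abs_sub_le_of_approx`, `SolitaryWave.exists_scale`). With
vanishing error the same estimate gives uniqueness and evenness of the tip profile; existence is by
quadrature.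

Outside of the tip all forces are `O(1 / σ) = O(ε ^ m)`. Hence `V` and `R` decay geometrically for
large arguments, `V(1 / 2 + y) = R(1 / 2) + R'(y) / 2 + O(ε ^ m)`,
`R(1 + y) = R(1 / 2) (1 - y) - R(y) / 2 + O(ε ^ m)`, and `R'(1 / 2) = - 2 R(1 / 2) + O(ε ^ m)`. The
last relation, combined with the asymptotics `S₀' → μ̄` and `x S₀' - S₀ → κ̄`
(`IsTipProfile.kappaBar_spec`, which needs `m > 1`), fixes the scale `μ` up to a relative error
`O(ε ^ m)` (`SolitaryWave.abs_slopeHat_sub_le`); this gives `μ̂_ε` and `σ̂_ε`. Inserting the tip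
profile into the two other relations yields a pointwise bound for the errors by
`C ε ^ m / (1 + x²)` (`exists_pointwise_approximation`), hence bounds in all `L^q` at once.

It remains to compare `ε` with `δ`. Cauchy–Schwarz on `[-1 / 2, 1 / 2]` gives `δ ≤ ε`. In the other
direction, the approximation shows that `(1 - δ)² = ‖V‖₂² ≤ (1 - ε)² + ∫ q² + o(ε)`, where `q` is
given by `(ε / μ̂) (μ̄ - S₀')`. The conserved energy of the tip equation implies
`(μ̄ - S₀')² ≤ (2 / m) S₀''`, so `∫ q² ≤ 2 ε / m + o(ε)`, and `δ ≥ (1 - 1 / m) ε - o(ε)`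
(`exists_amplitude_le`). Finally, `ε → 0` because waves with `R(0)` bounded away from `1` have
bounded potential energy.
-/

namespace FPU

/-! ### Calculus on intervals -/

/-- Integrated form of a derivative inequality. -/
lemma sub_le_sub_of_hasDerivAt_le {f g f' g' : ℝ → ℝ} {a b : ℝ} (hab : a ≤ b)
    (hf : ∀ x ∈ Icc a b, HasDerivAt f (f' x) x) (hg : ∀ x ∈ Icc a b, HasDerivAt g (g' x) x)
    (h : ∀ x ∈ Icc a b, f' x ≤ g' x) : f b - f a ≤ g b - g a := by
  have hmono : MonotoneOn (fun x => g x - f x) (Icc a b) := by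
    refine monotoneOn_of_hasDerivWithinAt_nonneg (f' := fun x => g' x - f' x) (convex_Icc a b)
      (fun x hx => ((hg x hx).sub (hf x hx)).continuousAt.continuousWithinAt)
      (fun x hx => ?_) (fun x hx => ?_)
    · have hx' := interior_subset hx
      exact ((hg x hx').sub (hf x hx')).hasDerivWithinAt
    · exact sub_nonneg.2 (h x (interior_subset hx))
  have := hmono (left_mem_Icc.2 hab) (right_mem_Icc.2 hab) hab
  simp only at this
  linarith

lemma abs_sub_le_of_hasDerivAt_abs_le {f f' : ℝ → ℝ} {a b K : ℝ} (hab : a ≤ b)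
    (hf : ∀ x ∈ Icc a b, HasDerivAt f (f' x) x) (h : ∀ x ∈ Icc a b, |f' x| ≤ K) :
    |f b - f a| ≤ K * (b - a) := by
  have hK : ∀ x ∈ Icc a b, HasDerivAt (fun x => K * x) K x := fun x _ => by
    simpa using (hasDerivAt_id x).const_mul K
  have hK' : ∀ x ∈ Icc a b, HasDerivAt (fun x => -K * x) (-K) x := fun x _ => by
    simpa using (hasDerivAt_id x).const_mul (-K)
  have h1 := sub_le_sub_of_hasDerivAt_le hab hf hK fun x hx => (abs_le.1 (h x hx)).2
  have h2 := sub_le_sub_of_hasDerivAt_le hab hK' hf fun x hx => (abs_le.1 (h x hx)).1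
  rw [abs_le]
  constructor <;> linarith

/-- A Gronwall estimate for `u'' = O(|u| / (1 + x)³) + O(f)` with zero initial data. The weight is
so small at infinity that the solution grows no faster than for `u'' = f`. -/
lemma abs_le_of_abs_second_deriv_le {u v w : ℝ → ℝ} {X L f : ℝ} (hL : 0 ≤ L) (hf : 0 ≤ f)
    (hu : ∀ x, HasDerivAt u (v x) x) (hv : ∀ x, HasDerivAt v (w x) x) (hw : Continuous w)
    (hu0 : u 0 = 0) (hv0 : v 0 = 0)
    (h : ∀ x ∈ Icc 0 X, |w x| ≤ L / (1 + x) ^ 3 * |u x| + f) :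
    ∀ x ∈ Icc 0 X, |v x| ≤ exp L * f * x ∧ |u x| ≤ exp L * f * x ^ 2 := by
  set φ : ℝ → ℝ := fun x => ∫ t in (0 : ℝ)..x, |w t| with hφ
  have hφd : ∀ x, HasDerivAt φ |w x| x := fun x =>
    intervalIntegral.integral_hasDerivAt_right (hw.abs.intervalIntegrable _ _)
      (hw.abs.stronglyMeasurableAtFilter _ _) hw.abs.continuousAt
  have hφ0 : φ 0 = 0 := by simp [hφ]
  have hvφ : ∀ x, 0 ≤ x → |v x| ≤ φ x := fun x hx => by
    have h1 := sub_le_sub_of_hasDerivAt_le hx (fun y _ => hv y) (fun y _ => hφd y)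
      fun y _ => le_abs_self _
    have h2 := sub_le_sub_of_hasDerivAt_le hx (fun y _ => (hv y).neg) (fun y _ => hφd y)
      fun y _ => neg_le_abs _
    simp only [Pi.neg_apply] at h2
    rw [abs_le]; constructor <;> linarith
  have hφmono : ∀ x y, 0 ≤ x → x ≤ y → φ x ≤ φ y := fun x y _ hxy => by
    have := sub_le_sub_of_hasDerivAt_le hxy (fun y _ => hasDerivAt_const y (0 : ℝ))
      (fun y _ => hφd y) fun y _ => abs_nonneg _
    linarith
  have huφ : ∀ x, 0 ≤ x → |u x| ≤ φ x * x := fun x hx => by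
    have := abs_sub_le_of_hasDerivAt_abs_le hx (fun y _ => hu y)
      fun y hy => (hvφ y hy.1).trans (hφmono y x hy.1 hy.2)
    simpa [hu0] using this
  have hφnn : ∀ x, 0 ≤ x → 0 ≤ φ x := fun x hx => (abs_nonneg _).trans (hvφ x hx)
  have key : ∀ x ∈ Icc 0 X, φ x ≤ exp L * f * x := fun x hx => by
    -- `exp (L / (1 + x))` is an integrating factor, bounded between `1` and `exp L`
    have hd : ∀ y ∈ Icc 0 x, HasDerivAt (fun y => φ y * exp (L / (1 + y)))
        (|w y| * exp (L / (1 + y)) + φ y * (exp (L / (1 + y)) * (-L / (1 + y) ^ 2))) y :=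
      fun y hy => by
        have hy1 : (1 + y) ≠ 0 := by linarith [hy.1]
        have h1 : HasDerivAt (fun y => L / (1 + y)) (-L / (1 + y) ^ 2) y := by
          simpa using (hasDerivAt_const y L).fun_div ((hasDerivAt_id y).const_add 1) hy1
        exact (hφd y).mul h1.exp
    have hd2 : ∀ y ∈ Icc 0 x, HasDerivAt (fun y => exp L * f * y) (exp L * f) y := fun y _ => by
      simpa using (hasDerivAt_id y).const_mul (exp L * f)
    have := sub_le_sub_of_hasDerivAt_le hx.1 hd hd2 fun y hy => by
      have hy0 := hy.1
      have h1y : 0 < 1 + y := by linarith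
      have hE : exp (L / (1 + y)) ≤ exp L := exp_le_exp.2 (div_le_self hL (by linarith))
      have hwy := h y ⟨hy.1, hy.2.trans hx.2⟩
      have h3 : L / (1 + y) ^ 3 * |u y| ≤ L / (1 + y) ^ 2 * φ y := by
        calc L / (1 + y) ^ 3 * |u y| ≤ L / (1 + y) ^ 3 * (φ y * y) := by
              gcongr; exact huφ y hy0
          _ ≤ L / (1 + y) ^ 3 * (φ y * (1 + y)) := by
              gcongr
              · exact hφnn y hy0
              · linarith
          _ = L / (1 + y) ^ 2 * φ y := by field_simp
      have h4 : |w y| + φ y * (-L / (1 + y) ^ 2) ≤ f := by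
        have : φ y * (-L / (1 + y) ^ 2) = -(L / (1 + y) ^ 2 * φ y) := by ring
        linarith
      calc _ = exp (L / (1 + y)) * (|w y| + φ y * (-L / (1 + y) ^ 2)) := by ring
        _ ≤ exp (L / (1 + y)) * f := by gcongr
        _ ≤ exp L * f := by gcongr
    simp only [hφ0, zero_mul, sub_zero, mul_zero] at this
    refine le_trans ?_ this
    exact le_mul_of_one_le_right (hφnn x hx.1)
      (one_le_exp (div_nonneg hL (by linarith [hx.1])))
  intro x hx
  refine ⟨(hvφ x hx.1).trans (key x hx), ?_⟩
  calc |u x| ≤ φ x * x := huφ x hx.1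
    _ ≤ exp L * f * x * x := mul_le_mul_of_nonneg_right (key x hx) hx.1
    _ = _ := by ring

/-! ### The tip equation -/

/-- The right hand side of the tip equation. -/
noncomputable def tipForce (m s : ℝ) : ℝ := 2 / (m + 1) * (1 / (1 + s) ^ (m + 1))

variable {m : ℝ}

lemma tipForce_eq {s : ℝ} (hs : -1 < s) :
    tipForce m s = 2 / (m + 1) * (1 + s) ^ (-(m + 1)) := by
  rw [tipForce, rpow_neg (by linarith), one_div]

lemma tipForce_pos (hm : 1 < m) {s : ℝ} (hs : -1 < s) : 0 < tipForce m s := by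
  have : 0 < 1 + s := by linarith
  have : 0 < m + 1 := by linarith
  unfold tipForce; positivity

lemma tipForce_le (hm : 1 < m) {s t : ℝ} (hs : -1 < s) (hst : s ≤ t) :
    tipForce m t ≤ tipForce m s := by
  have : 0 < 1 + s := by linarith
  have : 0 < m + 1 := by linarith
  unfold tipForce; gcongr

lemma tipForce_le_one (hm : 1 < m) {s : ℝ} (hs : 0 ≤ s) : tipForce m s ≤ 1 := by
  refine (tipForce_le hm (by norm_num) hs).trans ?_
  simp only [tipForce, add_zero, one_rpow, div_one, mul_one]
  rw [div_le_one (by linarith)]; linarith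

lemma hasDerivAt_tipForce (hm : 1 < m) {s : ℝ} (hs : -1 < s) :
    HasDerivAt (tipForce m) (-2 * (1 + s) ^ (-(m + 2))) s := by
  have h : HasDerivAt (fun s => 2 / (m + 1) * (1 + s) ^ (-(m + 1)))
      (2 / (m + 1) * (1 * (-(m + 1)) * (1 + s) ^ (-(m + 1) - 1))) s :=
    (((hasDerivAt_id s).const_add 1).rpow_const (Or.inl (by simp; linarith))).const_mul _
  have h2 : HasDerivAt (fun s => 2 / (m + 1) * (1 + s) ^ (-(m + 1)))
      (-2 * (1 + s) ^ (-(m + 2))) s := by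
    convert! h using 1
    rw [show -(m + 1) - 1 = -(m + 2) by ring]
    have : m + 1 ≠ 0 := by linarith
    field_simp
  refine h2.congr_of_eventuallyEq ?_
  filter_upwards [lt_mem_nhds hs] with t ht using tipForce_eq ht

/-- The tip force is Lipschitz with a constant that decays along linearly growing arguments. -/
lemma abs_tipForce_sub_le (hm : 1 < m) {c x s t : ℝ} (hc : 0 < c) (hx : 0 ≤ x)
    (hs : c * (1 + x) ≤ 1 + s) (ht : c * (1 + x) ≤ 1 + t) :
    |tipForce m s - tipForce m t| ≤ 2 * c ^ (-(m + 2)) / (1 + x) ^ 3 * |s - t| := by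
  wlog hts : t ≤ s generalizing s t
  · rw [abs_sub_comm, abs_sub_comm s]
    exact this ht hs (le_of_not_ge hts)
  have hcx : 0 < c * (1 + x) := by positivity
  have h := abs_sub_le_of_hasDerivAt_abs_le (f := tipForce m)
    (f' := fun s => -2 * (1 + s) ^ (-(m + 2))) (K := 2 * c ^ (-(m + 2)) / (1 + x) ^ 3) hts
    (fun y hy => hasDerivAt_tipForce hm (by linarith [hy.1])) fun y hy => by
      have hy1 : c * (1 + x) ≤ 1 + y := by linarith [hy.1]
      have hy2 : 0 < 1 + y := by linarith
      rw [abs_mul, abs_neg, abs_of_pos (rpow_pos_of_pos hy2 _), abs_two]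
      calc 2 * (1 + y) ^ (-(m + 2)) ≤ 2 * (c * (1 + x)) ^ (-(m + 2)) := by
            gcongr 2 * ?_
            exact rpow_le_rpow_of_nonpos hcx hy1 (by linarith)
        _ = 2 * c ^ (-(m + 2)) * (1 + x) ^ (-(m + 2)) := by
            rw [mul_rpow hc.le (by linarith)]; ring
        _ ≤ 2 * c ^ (-(m + 2)) * (1 + x) ^ (-3 : ℝ) := by
            gcongr
            · linarith
            · linarith
        _ = _ := by
            have h3 : (1 + x) ^ (-3 : ℝ) = ((1 + x) ^ 3)⁻¹ := by
              rw [rpow_neg (by linarith), ← rpow_natCast]; norm_num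
            rw [h3, div_eq_mul_inv]
  rwa [abs_of_nonneg (sub_nonneg.2 hts)]

/-- The slope lower bound in `one_add_ge_of_second_deriv`. -/
noncomputable def tipSlope (m : ℝ) : ℝ := 1 / 2 * tipForce m 1

lemma tipSlope_pos (hm : 1 < m) : 0 < tipSlope m :=
  mul_pos (by norm_num) (tipForce_pos hm (by norm_num))

lemma tipSlope_le_half (hm : 1 < m) : tipSlope m ≤ 1 / 2 := by
  have := tipForce_le_one hm (zero_le_one)
  unfold tipSlope; linarith

/-- Convex approximate solutions of the tip equation are nonnegative and grow at least linearly. -/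
lemma one_add_ge_of_second_deriv (hm : 1 < m) {S v w : ℝ → ℝ} {X f : ℝ} (hX : 1 ≤ X)
    (hS : ∀ x, HasDerivAt S (v x) x) (hv : ∀ x, HasDerivAt v (w x) x)
    (hS0 : S 0 = 0) (hv0 : v 0 = 0) (hf : f ≤ tipSlope m)
    (hw : ∀ x ∈ Icc 0 X, 0 ≤ w x)
    (h : ∀ x ∈ Icc 0 X, |w x - tipForce m (S x)| ≤ f) :
    ∀ x ∈ Icc 0 X, 0 ≤ S x ∧ tipSlope m * (x - 1) ≤ S x ∧
      tipSlope m / 2 * (1 + x) ≤ 1 + S x := by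
  have hc := tipSlope_pos hm
  have hc' := tipSlope_le_half hm
  have hvnn : ∀ x ∈ Icc 0 X, 0 ≤ v x := fun x hx => by
    have := sub_le_sub_of_hasDerivAt_le hx.1 (fun y _ => hasDerivAt_const y (0 : ℝ))
      (fun y _ => hv y) fun y hy => hw y ⟨hy.1, hy.2.trans hx.2⟩
    linarith
  have hSnn : ∀ x ∈ Icc 0 X, 0 ≤ S x := fun x hx => by
    have := sub_le_sub_of_hasDerivAt_le hx.1 (fun y _ => hasDerivAt_const y (0 : ℝ))
      (fun y _ => hS y) fun y hy => hvnn y ⟨hy.1, hy.2.trans hx.2⟩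
    linarith
  have hwle : ∀ x ∈ Icc 0 X, w x ≤ 3 / 2 := fun x hx => by
    have h1 := (abs_le.1 (h x hx)).2
    have h2 := tipForce_le_one hm (hSnn x hx)
    linarith
  have hvle : ∀ x ∈ Icc 0 X, v x ≤ 3 / 2 * x := fun x hx => by
    have := sub_le_sub_of_hasDerivAt_le hx.1 (fun y _ => hv y)
      (fun y _ => (by simpa using (hasDerivAt_id y).const_mul (3 / 2 : ℝ) :
        HasDerivAt (fun y => 3 / 2 * y) (3 / 2 : ℝ) y))
      fun y hy => hwle y ⟨hy.1, hy.2.trans hx.2⟩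
    linarith
  have hS1 : ∀ x ∈ Icc (0 : ℝ) 1, S x ≤ 1 := fun x hx => by
    have := sub_le_sub_of_hasDerivAt_le hx.1 (fun y _ => hS y)
      (fun y _ => (by convert! (hasDerivAt_pow 2 y).const_mul (3 / 4 : ℝ) using 1; norm_num; ring :
        HasDerivAt (fun y => 3 / 4 * y ^ 2) (3 / 2 * y : ℝ) y))
      fun y hy => hvle y ⟨hy.1, hy.2.trans (hx.2.trans hX)⟩
    nlinarith [hx.1, hx.2]
  have hv1 : tipSlope m ≤ v 1 := by
    have := sub_le_sub_of_hasDerivAt_le zero_le_one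
      (fun y _ => (by simpa using (hasDerivAt_id y).const_mul (tipSlope m) :
        HasDerivAt (fun y => tipSlope m * y) (tipSlope m) y))
      (fun y _ => hv y) fun y hy => by
        have h1 := (abs_le.1 (h y ⟨hy.1, hy.2.trans hX⟩)).1
        have h2 := tipForce_le hm (by linarith [hSnn y ⟨hy.1, hy.2.trans hX⟩]) (hS1 y hy)
        unfold tipSlope at *; linarith
    linarith
  have hlin : ∀ x ∈ Icc 0 X, tipSlope m * (x - 1) ≤ S x := fun x hx => by
    rcases le_total x 1 with h1 | h1
    · exact (mul_nonpos_of_nonneg_of_nonpos hc.le (by linarith)).trans (hSnn x hx)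
    · have hv2 : ∀ y ∈ Icc 1 x, tipSlope m ≤ v y := fun y hy => by
        have := sub_le_sub_of_hasDerivAt_le hy.1 (fun y _ => hasDerivAt_const y (0 : ℝ))
          (fun y _ => hv y) fun z hz =>
            hw z ⟨by linarith [hz.1], by linarith [hz.2, hy.2, hx.2]⟩
        linarith
      have := sub_le_sub_of_hasDerivAt_le h1
        (fun y _ => (by simpa using (hasDerivAt_id y).const_mul (tipSlope m) :
          HasDerivAt (fun y => tipSlope m * y) (tipSlope m) y))
        (fun y _ => hS y) hv2
      have := hSnn 1 ⟨zero_le_one, hX⟩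
      linarith
  intro x hx
  refine ⟨hSnn x hx, hlin x hx, ?_⟩
  have h1 := hlin x hx
  have h2 := hSnn x hx
  rcases le_total x 1 with hx1 | hx1 <;> nlinarith [hx.1]

namespace IsTipProfile

variable {S T : ℝ → ℝ}

lemma hasDerivAt (hS : IsTipProfile m S) (x : ℝ) : HasDerivAt S (deriv S x) x :=
  (hS.differentiable x).hasDerivAt

lemma hasDerivAt_deriv (hS : IsTipProfile m S) (x : ℝ) :
    HasDerivAt (deriv S) (tipForce m (S x)) x := hS.ode x

lemma continuous_force (hm : 1 < m) (hS : IsTipProfile m S) :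
    Continuous fun x => tipForce m (S x) :=
  continuous_iff_continuousAt.2 fun x =>
    ContinuousAt.comp (f := S) (g := tipForce m)
      (hasDerivAt_tipForce hm (hS.gt_neg_one x)).continuousAt (hS.hasDerivAt x).continuousAt

lemma growth (hm : 1 < m) (hS : IsTipProfile m S) {x : ℝ} (hx : 0 ≤ x) :
    0 ≤ S x ∧ tipSlope m * (x - 1) ≤ S x ∧ tipSlope m / 2 * (1 + x) ≤ 1 + S x :=
  one_add_ge_of_second_deriv hm (X := x + 1) (f := 0) (by linarith) hS.hasDerivAt
    hS.hasDerivAt_deriv hS.init hS.init_deriv (tipSlope_pos hm).le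
    (fun y _ => (tipForce_pos hm (hS.gt_neg_one y)).le) (fun y _ => by simp) x
    ⟨hx, by linarith⟩

/-- Stability of the tip profile: convex solutions of the tip equation up to an error `f` stay
close to it, with constants that do not depend on the length of the interval. -/
lemma abs_sub_le_of_approx (hm : 1 < m) (hS : IsTipProfile m S) {T v w : ℝ → ℝ} {X f : ℝ}
    (hX : 1 ≤ X) (hT : ∀ x, HasDerivAt T (v x) x) (hv : ∀ x, HasDerivAt v (w x) x)
    (hwc : Continuous w) (hT0 : T 0 = 0) (hv0 : v 0 = 0) (hf0 : 0 ≤ f) (hf : f ≤ tipSlope m)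
    (hw : ∀ x ∈ Icc 0 X, 0 ≤ w x)
    (h : ∀ x ∈ Icc 0 X, |w x - tipForce m (T x)| ≤ f) :
    ∀ x ∈ Icc 0 X,
      |v x - deriv S x| ≤ exp (2 * (tipSlope m / 2) ^ (-(m + 2))) * f * x ∧
      |T x - S x| ≤ exp (2 * (tipSlope m / 2) ^ (-(m + 2))) * f * x ^ 2 := by
  have hc := tipSlope_pos hm
  refine abs_le_of_abs_second_deriv_le (u := fun x => T x - S x)
    (v := fun x => v x - deriv S x) (w := fun x => w x - tipForce m (S x)) (by positivity) hf0
    (fun x => (hT x).sub (hS.hasDerivAt x)) (fun x => (hv x).sub (hS.hasDerivAt_deriv x))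
    (hwc.sub (hS.continuous_force hm)) (by simp [hT0, hS.init]) (by simp [hv0, hS.init_deriv])
    fun x hx => ?_
  have hg := one_add_ge_of_second_deriv hm hX hT hv hT0 hv0 hf hw h x hx
  have hl := abs_tipForce_sub_le hm (by positivity) hx.1 hg.2.2 (hS.growth hm hx.1).2.2
  calc |w x - tipForce m (S x)|
      = |(tipForce m (T x) - tipForce m (S x)) + (w x - tipForce m (T x))| := by ring_nf
    _ ≤ _ := (abs_add_le _ _).trans (add_le_add hl (h x hx))

lemma eq_of_nonneg (hm : 1 < m) (hS : IsTipProfile m S) (hT : IsTipProfile m T) {x : ℝ}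
    (hx : 0 ≤ x) : T x = S x := by
  have h := (hS.abs_sub_le_of_approx hm (X := x + 1) (f := 0) (by linarith) hT.hasDerivAt
    hT.hasDerivAt_deriv (hT.continuous_force hm) hT.init hT.init_deriv le_rfl
    (tipSlope_pos hm).le (fun y _ => (tipForce_pos hm (hT.gt_neg_one y)).le)
    (fun y _ => by simp) x ⟨hx, by linarith⟩).2
  have h0 : |T x - S x| ≤ 0 := by simpa using h
  exact sub_eq_zero.1 (abs_nonpos_iff.1 h0)

lemma deriv_comp_neg (S : ℝ → ℝ) : deriv (fun x => S (-x)) = fun x => -deriv S (-x) := by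
  ext x; exact _root_.deriv_comp_neg S x

lemma comp_neg (hS : IsTipProfile m S) : IsTipProfile m fun x => S (-x) where
  init := by simp [hS.init]
  init_deriv := by rw [deriv_comp_neg]; simp [hS.init_deriv]
  gt_neg_one x := hS.gt_neg_one _
  differentiable := hS.differentiable.comp differentiable_neg
  ode x := by
    rw [deriv_comp_neg]
    have := ((hS.ode (-x)).comp x (hasDerivAt_neg x)).neg
    convert! this using 1
    simp

lemma even (hm : 1 < m) (hS : IsTipProfile m S) (x : ℝ) : S (-x) = S x := by
  rcases le_total 0 x with hx | hx
  · exact hS.eq_of_nonneg hm hS.comp_neg hx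
  · have := hS.eq_of_nonneg hm hS.comp_neg (neg_nonneg.2 hx)
    simpa using this.symm

lemma deriv_odd (hm : 1 < m) (hS : IsTipProfile m S) (x : ℝ) : deriv S (-x) = -deriv S x := by
  have h : (fun x => S (-x)) = S := funext (hS.even hm)
  have h2 := congrFun (deriv_comp_neg S) x
  rw [h] at h2
  linarith

lemma unique (hm : 1 < m) (hS : IsTipProfile m S) (hT : IsTipProfile m T) : T = S := by
  ext x
  rcases le_total 0 x with hx | hx
  · exact hS.eq_of_nonneg hm hT hx
  · rw [← hS.even hm, ← hT.even hm]
    exact hS.eq_of_nonneg hm hT (neg_nonneg.2 hx)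

lemma deriv_nonneg (hm : 1 < m) (hS : IsTipProfile m S) {x : ℝ} (hx : 0 ≤ x) :
    0 ≤ deriv S x := by
  have := sub_le_sub_of_hasDerivAt_le hx (fun y _ => hasDerivAt_const y (0 : ℝ))
    (fun y _ => hS.hasDerivAt_deriv y) fun y _ => (tipForce_pos hm (hS.gt_neg_one y)).le
  linarith [hS.init_deriv]

end IsTipProfile

lemma muBar_pos (hm : 1 < m) : 0 < muBar m := by
  have : 0 < m := by linarith
  unfold muBar; positivity

lemma muBar_sq (hm : 1 < m) : muBar m ^ 2 = 4 / (m * (m + 1)) := by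
  have : 0 < m := by linarith
  rw [muBar, div_pow, sq_sqrt (by positivity)]; norm_num

namespace IsTipProfile

variable {S T : ℝ → ℝ}

/-- Conservation of energy for the tip equation. -/
lemma deriv_sq (hm : 1 < m) (hS : IsTipProfile m S) (x : ℝ) :
    deriv S x ^ 2 = muBar m ^ 2 * (1 - (1 + S x) ^ (-m)) := by
  have hd : ∀ y, HasDerivAt (fun y => deriv S y ^ 2 - muBar m ^ 2 * (1 - (1 + S y) ^ (-m))) 0 y :=
    fun y => by
      have hy : 0 < 1 + S y := by linarith [hS.gt_neg_one y]
      have h1 := ((hS.hasDerivAt y).const_add 1).rpow_const (p := -m) (Or.inl hy.ne')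
      have h2 := ((hS.hasDerivAt_deriv y).pow 2).sub ((h1.const_sub 1).const_mul (muBar m ^ 2))
      convert! h2 using 1
      rw [muBar_sq hm, tipForce_eq (hS.gt_neg_one y), show -m - 1 = -(m + 1) by ring]
      have : m ≠ 0 := by linarith
      have : m + 1 ≠ 0 := by linarith
      field_simp
      ring
  have := is_const_of_deriv_eq_zero (fun y => (hd y).differentiableAt) (fun y => (hd y).deriv) x 0
  simp only [hS.init, hS.init_deriv] at this
  norm_num at this
  linarith

lemma deriv_le_muBar (hm : 1 < m) (hS : IsTipProfile m S) (x : ℝ) : deriv S x ≤ muBar m := by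
  have h := hS.deriv_sq hm x
  have h1 : 0 < (1 + S x) ^ (-m) := rpow_pos_of_pos (by linarith [hS.gt_neg_one x]) _
  exact (le_abs_self _).trans
    (abs_le_of_sq_le_sq (by nlinarith [sq_nonneg (muBar m)]) (muBar_pos hm).le)

lemma le_muBar_mul (hm : 1 < m) (hS : IsTipProfile m S) {x : ℝ} (hx : 0 ≤ x) :
    S x ≤ muBar m * x := by
  have := sub_le_sub_of_hasDerivAt_le hx (fun y _ => hS.hasDerivAt y)
    (fun y _ => (by simpa using (hasDerivAt_id y).const_mul (muBar m) :
      HasDerivAt (fun y => muBar m * y) (muBar m) y)) fun y _ => hS.deriv_le_muBar hm y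
  linarith [hS.init]

lemma rpow_le (hm : 1 < m) (hS : IsTipProfile m S) {x p : ℝ} (hx : 0 ≤ x) (hp : p ≤ 0) :
    (1 + S x) ^ p ≤ (tipSlope m / 2) ^ p * (1 + x) ^ p := by
  have hc := tipSlope_pos hm
  rw [← mul_rpow (by linarith) (by linarith)]
  exact rpow_le_rpow_of_nonpos (by positivity) (hS.growth hm hx).2.2 hp

lemma muBar_sub_deriv_le (hm : 1 < m) (hS : IsTipProfile m S) {x : ℝ} (hx : 0 ≤ x) :
    muBar m - deriv S x ≤ muBar m * (tipSlope m / 2) ^ (-m) * (1 + x) ^ (-m) := by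
  have h := hS.deriv_sq hm x
  have h1 := hS.rpow_le hm hx (p := -m) (by linarith)
  have h2 := hS.deriv_nonneg hm hx
  have h3 := muBar_pos hm
  have h4 := hS.deriv_le_muBar hm x
  have h5 : (muBar m - deriv S x) * muBar m ≤ (muBar m * (1 + S x) ^ (-m)) * muBar m := by
    nlinarith
  have h6 := le_of_mul_le_mul_right h5 h3
  calc _ ≤ _ := h6
    _ ≤ muBar m * ((tipSlope m / 2) ^ (-m) * (1 + x) ^ (-m)) := by gcongr
    _ = _ := by ring

lemma tipForce_le_rpow (hm : 1 < m) (hS : IsTipProfile m S) {x : ℝ} (hx : 0 ≤ x) :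
    tipForce m (S x) ≤ (tipSlope m / 2) ^ (-(m + 1)) * (1 + x) ^ (-(m + 1)) := by
  rw [tipForce_eq (hS.gt_neg_one x)]
  refine le_trans ?_ (hS.rpow_le hm hx (p := -(m + 1)) (by linarith))
  refine mul_le_of_le_one_left (rpow_nonneg (by linarith [hS.gt_neg_one x]) _) ?_
  rw [div_le_one (by linarith)]; linarith

/-- `x S''(x)` decays like `(1 + x) ^ (-m)`. -/
lemma mul_tipForce_le (hm : 1 < m) (hS : IsTipProfile m S) {x : ℝ} (hx : 0 ≤ x) :
    x * tipForce m (S x) ≤ (tipSlope m / 2) ^ (-(m + 1)) * (1 + x) ^ (-m) := by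
  have h0 := tipForce_pos hm (hS.gt_neg_one x)
  have hc := tipSlope_pos hm
  calc x * tipForce m (S x) ≤ (1 + x) * ((tipSlope m / 2) ^ (-(m + 1)) * (1 + x) ^ (-(m + 1))) := by
        gcongr
        · linarith
        · exact hS.tipForce_le_rpow hm hx
    _ = (tipSlope m / 2) ^ (-(m + 1)) * ((1 + x) ^ (1 : ℝ) * (1 + x) ^ (-(m + 1))) := by
        rw [rpow_one]; ring
    _ = _ := by
        rw [← rpow_add (by linarith)]
        congr 2; ring

lemma mul_tipForce_le' (hm : 1 < m) (hS : IsTipProfile m S) {x : ℝ} (hx : 0 ≤ x) :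
    x * tipForce m (S x) ≤ (tipSlope m / 2) ^ (-(m + 1)) := by
  have hc := tipSlope_pos hm
  refine (hS.mul_tipForce_le hm hx).trans ?_
  refine mul_le_of_le_one_right (by positivity) ?_
  exact rpow_le_one_of_one_le_of_nonpos (by linarith) (by linarith)

/-- The constant in the convergence rate of `x S'(x) - S(x)` to `κ̄`. -/
noncomputable def kappaRate (m : ℝ) : ℝ := (tipSlope m / 2) ^ (-(m + 1)) / (m - 1)

lemma hasDerivAt_mul_deriv_sub (hS : IsTipProfile m S) (x : ℝ) :
    HasDerivAt (fun x => x * deriv S x - S x) (x * tipForce m (S x)) x := by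
  have := ((hasDerivAt_id x).mul (hS.hasDerivAt_deriv x)).sub (hS.hasDerivAt x)
  convert! this using 1
  simp

/-- The integrand of `κ̄` is integrable, and the partial integrals `x S'(x) - S(x)` converge to
`κ̄` from below with rate `x ^ (1 - m)`. -/
lemma kappaBar_spec (hm : 1 < m) (hS : IsTipProfile m S) :
    IntegrableOn (fun x => x * deriv (deriv S) x) (Ioi 0) ∧
    ∀ x, 0 ≤ x → x * deriv S x - S x ≤ kappaBar S ∧
      kappaBar S - (x * deriv S x - S x) ≤ kappaRate m * (1 + x) ^ (1 - m) := by
  set k : ℝ → ℝ := fun x => x * deriv S x - S x with hk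
  have hkd := hS.hasDerivAt_mul_deriv_sub
  have hm1 : 0 < m - 1 := by linarith
  have hc := tipSlope_pos hm
  have hA : 0 < kappaRate m := by unfold kappaRate; positivity
  have hfnn : ∀ x, 0 ≤ x → 0 ≤ x * tipForce m (S x) := fun x hx =>
    mul_nonneg hx (tipForce_pos hm (hS.gt_neg_one x)).le
  have hmono : ∀ a b, 0 ≤ a → a ≤ b → k a ≤ k b := fun a b ha hab => by
    have := sub_le_sub_of_hasDerivAt_le hab (fun y _ => hasDerivAt_const y (0 : ℝ))
      (fun y _ => hkd y) fun y hy => hfnn y (ha.trans hy.1)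
    linarith
  have hrate : ∀ a b, 0 ≤ a → a ≤ b → k b - k a ≤ kappaRate m * (1 + a) ^ (1 - m) :=
    fun a b ha hab => by
      have hd : ∀ y ∈ Icc a b, HasDerivAt (fun y => -(kappaRate m * (1 + y) ^ (1 - m)))
          ((tipSlope m / 2) ^ (-(m + 1)) * (1 + y) ^ (-m)) y := fun y hy => by
        have hy : 0 < 1 + y := by linarith [hy.1]
        have h1 := ((((hasDerivAt_id y).const_add 1).rpow_const (p := 1 - m)
          (Or.inl hy.ne')).const_mul (kappaRate m)).neg
        convert! h1 using 1
        simp only [id]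
        rw [show 1 - m - 1 = -m by ring, kappaRate]
        field_simp
        ring
      have := sub_le_sub_of_hasDerivAt_le hab (fun y _ => hkd y) hd
        fun y hy => hS.mul_tipForce_le hm (ha.trans hy.1)
      have hb : 0 ≤ kappaRate m * (1 + b) ^ (1 - m) :=
        mul_nonneg hA.le (rpow_nonneg (by linarith) _)
      simp only [hk] at this ⊢
      linarith
  have hk0 : k 0 = 0 := by simp [hk, hS.init]
  have hbdd : ∀ b, k (max b 0) ≤ kappaRate m := fun b => by
    have := hrate 0 (max b 0) le_rfl (le_max_right _ _)
    simpa [hk0] using this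
  have htend : Tendsto (fun b => k (max b 0)) atTop (𝓝 (⨆ b, k (max b 0))) :=
    tendsto_atTop_ciSup (fun a b hab => hmono _ _ (le_max_right _ _) (max_le_max_right 0 hab))
      ⟨kappaRate m, by rintro _ ⟨b, rfl⟩; exact hbdd b⟩
  set l := ⨆ b, k (max b 0)
  have htend' : Tendsto k atTop (𝓝 l) := htend.congr' <| by
    filter_upwards [eventually_ge_atTop 0] with b hb
    rw [max_eq_left hb]
  have hdd : (fun x => x * deriv (deriv S) x) = fun x => x * tipForce m (S x) := by
    ext x; rw [(hS.hasDerivAt_deriv x).deriv]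
  have hint := integrableOn_Ioi_deriv_of_nonneg' (fun x _ => hkd x)
    (fun x hx => hfnn x (le_of_lt hx)) htend'
  have hval := integral_Ioi_of_hasDerivAt_of_nonneg' (fun x _ => hkd x)
    (fun x hx => hfnn x (le_of_lt hx)) htend'
  have hkl : kappaBar S = l := by
    rw [kappaBar, hdd, hval]
    simp [hS.init]
  refine ⟨by rw [hdd]; exact hint, fun x hx => ?_⟩
  rw [hkl]
  constructor
  · exact ge_of_tendsto htend' (by
      filter_upwards [eventually_ge_atTop x] with b hb using hmono x b hx hb)
  · have : Tendsto (fun b => k b - k x) atTop (𝓝 (l - k x)) := htend'.sub_const _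
    exact le_of_tendsto this (by
      filter_upwards [eventually_ge_atTop x] with b hb using hrate x b hx hb)

lemma kappaBar_nonneg (hm : 1 < m) (hS : IsTipProfile m S) : 0 ≤ kappaBar S := by
  have := ((hS.kappaBar_spec hm).2 0 le_rfl).1
  simpa [hS.init] using this

/-- With `w = S' / μ̄` this is `(1 - w) ^ 2 ≤ (1 - w ^ 2) ^ (1 + 1 / m)`. -/
lemma sq_muBar_sub_deriv_le (hm : 1 < m) (hS : IsTipProfile m S) (x : ℝ) (hx : 0 ≤ x) :
    (muBar m - deriv S x) ^ 2 ≤ 2 / m * tipForce m (S x) := by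
  have hm0 : 0 < m := by linarith
  have hμ := muBar_pos hm
  set q := (1 + S x) ^ (-m) with hq
  have h1S : 1 ≤ 1 + S x := by linarith [(hS.growth hm hx).1]
  have hq0 : 0 < q := rpow_pos_of_pos (by linarith) _
  have hq1 : q ≤ 1 := rpow_le_one_of_one_le_of_nonpos h1S (by linarith)
  have hsq := hS.deriv_sq hm x
  have hd0 := hS.deriv_nonneg hm hx
  have hd1 := hS.deriv_le_muBar hm x
  rw [← hq] at hsq
  -- `1 - w ≤ q` and `q ^ 2 ≤ q ^ (1 + 1 / m)`, since `q ≤ 1`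
  have h1 : muBar m - deriv S x ≤ muBar m * q := by
    have : (muBar m - deriv S x) * muBar m ≤ (muBar m * q) * muBar m := by nlinarith
    exact le_of_mul_le_mul_right this hμ
  have h2 : (muBar m - deriv S x) ^ 2 ≤ (muBar m * q) ^ 2 :=
    pow_le_pow_left₀ (by linarith) h1 2
  have h3 : q ^ 2 ≤ (1 + S x) ^ (-(m + 1)) := by
    rw [hq, ← rpow_natCast, ← rpow_mul (by linarith)]
    refine rpow_le_rpow_of_exponent_le h1S ?_
    push_cast; linarith
  calc _ ≤ muBar m ^ 2 * q ^ 2 := by rw [← mul_pow]; exact h2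
    _ ≤ muBar m ^ 2 * (1 + S x) ^ (-(m + 1)) := by gcongr
    _ = _ := by
      rw [tipForce_eq (hS.gt_neg_one x), muBar_sq hm]
      field_simp
      norm_num

end IsTipProfile

/-! ### Existence of the tip profile -/

/-- The tip equation is solved by quadrature: with `C ^ 2 = (m + 1) / m`, the function
`x(p) = C ∫₀ᵖ (1 + q²) ^ (1 / m - 1 / 2) dq` is a diffeomorphism of the line, and
`S = (1 + p²) ^ (1 / m) - 1` is the tip profile in terms of its inverse. -/
lemma exists_isTipProfile (hm : 1 < m) : ∃ S, IsTipProfile m S := by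
  have hm0 : 0 < m := by linarith
  set C : ℝ := √((m + 1) / m) with hC
  have hC2 : C ^ 2 = (m + 1) / m := sq_sqrt (by positivity)
  have hC0 : 0 < C := sqrt_pos.2 (by positivity)
  have hq : ∀ q : ℝ, 0 < 1 + q ^ 2 := fun q => by positivity
  set g : ℝ → ℝ := fun q => C * (1 + q ^ 2) ^ (1 / m - 1 / 2) with hg
  have hgc : Continuous g :=
    continuous_const.mul ((by fun_prop : Continuous fun q : ℝ => 1 + q ^ 2).rpow_const
      fun q => Or.inl (hq q).ne')
  have hgpos : ∀ q, 0 < g q := fun q => mul_pos hC0 (rpow_pos_of_pos (hq q) _)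
  set G : ℝ → ℝ := fun p => ∫ q in (0 : ℝ)..p, g q with hG
  have hGd : ∀ p, HasDerivAt G (g p) p := fun p =>
    intervalIntegral.integral_hasDerivAt_right (hgc.intervalIntegrable _ _)
      (hgc.stronglyMeasurableAtFilter _ _) hgc.continuousAt
  have hG0 : G 0 = 0 := by simp [hG]
  have hGmono : StrictMono G := strictMono_of_hasDerivAt_pos hGd hgpos
  have hGcont : Continuous G := continuous_iff_continuousAt.2 fun p => (hGd p).continuousAt
  have hGodd : ∀ p, G (-p) = -G p := fun p => by
    have heven : ∀ q, g (-q) = g q := fun q => by simp [hg]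
    have h1 : ∫ q in (0 : ℝ)..p, g (-q) = ∫ q in (-p)..(-0), g q :=
      intervalIntegral.integral_comp_neg g
    simp only [heven, neg_zero] at h1
    simp only [hG]
    rw [h1, intervalIntegral.integral_symm]
  have hGge : ∀ p, 0 ≤ p → C * arsinh p ≤ G p := fun p hp => by
    have := sub_le_sub_of_hasDerivAt_le hp
      (fun q _ => (hasDerivAt_arsinh q).const_mul C) (fun q _ => hGd q) fun q _ => by
        simp only [hg]
        gcongr
        rw [sqrt_eq_rpow, ← rpow_neg (hq q).le]
        refine rpow_le_rpow_of_exponent_le (by nlinarith [sq_nonneg q]) ?_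
        have : 0 < 1 / m := by positivity
        linarith
    simpa [hG0] using this
  have hGsurj : Function.Surjective G := by
    have hpos : ∀ y, 0 ≤ y → ∃ p, G p = y := fun y hy => by
      have h2 : 0 ≤ sinh (y / C) := sinh_nonneg_iff.2 (by positivity)
      have h1 : y ≤ G (sinh (y / C)) := by
        have := hGge (sinh (y / C)) h2
        rw [arsinh_sinh, mul_div_cancel₀ _ hC0.ne'] at this
        exact this
      obtain ⟨p, -, hp⟩ := intermediate_value_Icc h2 hGcont.continuousOn
        (show y ∈ Icc (G 0) _ from ⟨by rw [hG0]; exact hy, h1⟩)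
      exact ⟨p, hp⟩
    intro y
    rcases le_total 0 y with hy | hy
    · exact hpos y hy
    · obtain ⟨p, hp⟩ := hpos (-y) (by linarith)
      exact ⟨-p, by rw [hGodd, hp, neg_neg]⟩
  set P : ℝ → ℝ := ⇑(hGmono.orderIsoOfSurjective G hGsurj).symm with hP
  have hGP : ∀ x, G (P x) = x := fun x =>
    (hGmono.orderIsoOfSurjective G hGsurj).apply_symm_apply x
  have hPc : Continuous P := (hGmono.orderIsoOfSurjective G hGsurj).symm.continuous
  have hPd : ∀ x, HasDerivAt P (g (P x))⁻¹ x := fun x =>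
    (hGd (P x)).of_local_left_inverse hPc.continuousAt (hgpos _).ne'
      (Eventually.of_forall hGP)
  have hP0 : P 0 = 0 := hGmono.injective (by rw [hGP, hG0])
  set S : ℝ → ℝ := fun x => (1 + P x ^ 2) ^ (1 / m) - 1 with hS
  have hginv : ∀ p, (g p)⁻¹ = C⁻¹ * (1 + p ^ 2) ^ (1 / 2 - 1 / m) := fun p => by
    rw [hg, mul_inv, ← rpow_neg (hq p).le, neg_sub]
  have hsqd : ∀ x, HasDerivAt (fun x => 1 + P x ^ 2) (2 * P x * (g (P x))⁻¹) x := fun x => by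
    simpa using ((hPd x).pow 2).const_add 1
  have hSd : ∀ x, HasDerivAt S (2 / (m * C) * (P x * (1 + P x ^ 2) ^ (-(1 / 2) : ℝ))) x := by
    intro x
    have h := ((hsqd x).rpow_const (p := 1 / m) (Or.inl (hq _).ne')).sub_const 1
    convert! h using 1
    rw [hginv, show (-(1 / 2) : ℝ) = (1 / 2 - 1 / m) + (1 / m - 1) by ring, rpow_add (hq _)]
    field_simp
  have hSderiv : deriv S = fun x => 2 / (m * C) * (P x * (1 + P x ^ 2) ^ (-(1 / 2) : ℝ)) :=
    funext fun x => (hSd x).deriv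
  refine ⟨S, ?_, ?_, ?_, fun x => (hSd x).differentiableAt, ?_⟩
  · simp [hS, hP0]
  · simp [hSderiv, hP0]
  · intro x
    have := rpow_pos_of_pos (hq (P x)) (1 / m)
    simp only [hS]; linarith
  · intro x
    rw [hSderiv]
    have h := ((hPd x).mul ((hsqd x).rpow_const (p := (-(1 / 2) : ℝ))
      (Or.inl (hq _).ne'))).const_mul (2 / (m * C))
    convert! h using 1
    have hb := hq (P x)
    set b := 1 + P x ^ 2 with hbdef
    have hP2 : P x ^ 2 = b - 1 := by rw [hbdef]; ring
    have e1 : (1 + S x) ^ (m + 1) = b ^ (1 / m) * b := by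
      simp only [hS]
      rw [add_sub_cancel, ← rpow_mul hb.le, show 1 / m * (m + 1) = 1 / m + 1 by field_simp; ring,
        rpow_add hb, rpow_one]
    have e2 : b ^ (-(1 / 2) - 1 : ℝ) = b ^ (-(1 / 2) : ℝ) / b := by
      rw [rpow_sub hb, rpow_one]
    have e3 : b ^ (1 / 2 - 1 / m) = b ^ (1 / 2 : ℝ) / b ^ (1 / m) := by rw [rpow_sub hb]
    have e4 : b ^ (-(1 / 2) : ℝ) = (b ^ (1 / 2 : ℝ))⁻¹ := rpow_neg hb.le _
    have hb1 : 0 < b ^ (1 / 2 : ℝ) := rpow_pos_of_pos hb _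
    have hb2 : 0 < b ^ (1 / m) := rpow_pos_of_pos hb _
    rw [e1, e2, hginv, ← hbdef, e3, e4]
    have e5 : 2 / (m + 1) = 2 / (m * C ^ 2) := by rw [hC2]; field_simp
    rw [e5]
    field_simp
    rw [hP2]
    ring

lemma existsUnique_isTipProfile (hm : 1 < m) : ∃! S, IsTipProfile m S := by
  obtain ⟨S, hS⟩ := exists_isTipProfile hm
  exact ⟨S, hS, fun T hT => hS.unique hm hT⟩

/-! ### The interaction force -/

/-- The derivative of the interaction potential. -/
noncomputable def stress (m r : ℝ) : ℝ := 1 / (m + 1) * ((1 - r) ^ (-(m + 1)) - 1)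

lemma hasDerivAt_potential (hm : 1 < m) {r : ℝ} (hr : r < 1) :
    HasDerivAt (potential m) (stress m r) r := by
  have h1 : HasDerivAt (fun r => 1 / (m * (m + 1)) * ((1 - r) ^ (-m) - m * r - 1))
      (stress m r) r := by
    have hb : (1 - r) ≠ 0 := by linarith
    have h := ((((((hasDerivAt_id r).const_sub 1).rpow_const (p := -m) (Or.inl hb)).sub
      ((hasDerivAt_id r).const_mul m)).sub_const 1)).const_mul (1 / (m * (m + 1)))
    convert! h using 1
    have h0 : m ≠ 0 := by linarith
    have h0' : m + 1 ≠ 0 := by linarith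
    simp only [stress, id]
    rw [show -m - 1 = -(m + 1) by ring]
    field_simp
  refine h1.congr_of_eventuallyEq ?_
  filter_upwards [gt_mem_nhds hr] with t ht
  rw [potential, rpow_neg (by linarith), one_div ((1 - t) ^ m)]

lemma hasDerivAt_stress (hm : 1 < m) {r : ℝ} (hr : r < 1) :
    HasDerivAt (stress m) ((1 - r) ^ (-(m + 2))) r := by
  have hb : (1 - r) ≠ 0 := by linarith
  have h := ((((hasDerivAt_id r).const_sub 1).rpow_const (p := -(m + 1))
    (Or.inl hb)).sub_const 1).const_mul (1 / (m + 1))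
  convert! h using 1
  have h0' : m + 1 ≠ 0 := by linarith
  simp only [id]
  rw [show -(m + 1) - 1 = -(m + 2) by ring]
  field_simp

lemma stress_zero : stress m 0 = 0 := by simp [stress]

lemma stress_mono (hm : 1 < m) {r s : ℝ} (hrs : r ≤ s) (hs : s < 1) : stress m r ≤ stress m s := by
  have : 0 < 1 / (m + 1) := by
    have : 0 < m + 1 := by linarith
    positivity
  unfold stress
  gcongr ?_ * (?_ - 1)
  exact rpow_le_rpow_of_nonpos (by linarith) (by linarith) (by linarith)

lemma stress_nonneg (hm : 1 < m) {r : ℝ} (hr : 0 ≤ r) (hr1 : r < 1) : 0 ≤ stress m r :=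
  stress_zero (m := m) ▸ stress_mono hm hr hr1

/-- A Lipschitz constant of the force for distances up to `3 / 4`. -/
noncomputable def stressBound (m : ℝ) : ℝ := 4 ^ (m + 2)

lemma stressBound_pos : 0 < stressBound m := rpow_pos_of_pos (by norm_num) _

lemma stress_le_rpow_mul (hm : 1 < m) {c r : ℝ} (hc : 0 < c) (hr : 0 ≤ r) (hr1 : r ≤ 1 - c) :
    stress m r ≤ c ^ (-(m + 2)) * r := by
  have h := abs_sub_le_of_hasDerivAt_abs_le (K := c ^ (-(m + 2))) hr
    (fun y hy => hasDerivAt_stress hm (by linarith [hy.2])) fun y hy => by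
      have hy1 : c ≤ 1 - y := by linarith [hy.2]
      rw [abs_of_pos (rpow_pos_of_pos (by linarith) _)]
      exact rpow_le_rpow_of_nonpos hc hy1 (by linarith)
  rw [stress_zero, sub_zero, sub_zero] at h
  exact (le_abs_self _).trans h

lemma stress_le_mul (hm : 1 < m) {r : ℝ} (hr : 0 ≤ r) (hr1 : r ≤ 3 / 4) :
    stress m r ≤ stressBound m * r := by
  have h := stress_le_rpow_mul hm (c := 1 / 4) (by norm_num) hr (by linarith)
  rwa [one_div, inv_rpow (by norm_num), ← rpow_neg (by norm_num), neg_neg] at h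

lemma stress_le (hm : 1 < m) {r : ℝ} (hr : 0 ≤ r) (hr1 : r ≤ 3 / 4) :
    stress m r ≤ stressBound m := by
  have := stress_le_mul hm hr hr1
  nlinarith [stressBound_pos (m := m)]

/-! ### Convolution with an indicator function -/

lemma tendsto_atTop_zero_of_antitoneOn_of_integrable_sq {f : ℝ → ℝ} (hf : Continuous f)
    (h0 : ∀ x, 0 ≤ f x) (hanti : AntitoneOn f (Ici 0)) (hint : Integrable fun x => f x ^ 2) :
    Tendsto f atTop (𝓝 0) := by
  set A := ∫ x, f x ^ 2
  have h1 : ∀ x, 0 < x → f x ^ 2 ≤ A * x⁻¹ := fun x hx => by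
    have h2 : ∫ t in (0 : ℝ)..x, f x ^ 2 ≤ ∫ t in (0 : ℝ)..x, f t ^ 2 :=
      intervalIntegral.integral_mono_on hx.le (by simp)
        ((hf.pow 2).intervalIntegrable _ _) fun t ht =>
          pow_le_pow_left₀ (h0 x) (hanti ht.1 hx.le ht.2) 2
    have h3 : ∫ t in (0 : ℝ)..x, f t ^ 2 ≤ A := by
      rw [intervalIntegral.integral_of_le hx.le]
      exact setIntegral_le_integral hint (Eventually.of_forall fun t => sq_nonneg _)
    rw [intervalIntegral.integral_const, smul_eq_mul, sub_zero] at h2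
    rw [← div_eq_mul_inv, le_div_iff₀ hx]
    linarith
  have h2 : Tendsto (fun x => f x ^ 2) atTop (𝓝 0) := by
    refine squeeze_zero' (Eventually.of_forall fun x => sq_nonneg _)
      ((eventually_gt_atTop 0).mono h1) ?_
    simpa using tendsto_inv_atTop_zero.const_mul A
  have h3 := h2.sqrt
  simpa [sqrt_sq (h0 _)] using h3

lemma eq_integral_of_deriv_eq_sub {f g : ℝ → ℝ} (hg : Continuous g)
    (hf : ∀ x, HasDerivAt f (g (x + 1 / 2) - g (x - 1 / 2)) x)
    (hf0 : Tendsto f atTop (𝓝 0)) (hg0 : Tendsto g atTop (𝓝 0)) (x : ℝ) :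
    f x = ∫ t in (x - 1 / 2)..(x + 1 / 2), g t := by
  set G : ℝ → ℝ := fun x => ∫ t in (0 : ℝ)..x, g t with hG
  have hGd : ∀ x, HasDerivAt G (g x) x := fun x =>
    intervalIntegral.integral_hasDerivAt_right (hg.intervalIntegrable _ _)
      (hg.stronglyMeasurableAtFilter _ _) hg.continuousAt
  have hGi : ∀ x, ∫ t in (x - 1 / 2)..(x + 1 / 2), g t = G (x + 1 / 2) - G (x - 1 / 2) := fun x =>
    (intervalIntegral.integral_interval_sub_left (hg.intervalIntegrable _ _)
      (hg.intervalIntegrable _ _)).symm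
  have hd : ∀ x, HasDerivAt (fun x => f x - (G (x + 1 / 2) - G (x - 1 / 2))) 0 x := fun x => by
    have h1 := (hGd (x + 1 / 2)).comp_add_const x (1 / 2)
    have h2 := (hGd (x - 1 / 2)).comp_sub_const x (1 / 2)
    simpa using (hf x).fun_sub (h1.fun_sub h2)
  have hconst : ∀ y, f y - (G (y + 1 / 2) - G (y - 1 / 2))
      = f x - (G (x + 1 / 2) - G (x - 1 / 2)) := fun y =>
    is_const_of_deriv_eq_zero (fun y => (hd y).differentiableAt) (fun y => (hd y).deriv) y x
  have hlim : Tendsto (fun y => G (y + 1 / 2) - G (y - 1 / 2)) atTop (𝓝 0) := by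
    rw [Metric.tendsto_atTop]
    intro η hη
    obtain ⟨N, hN⟩ := Metric.tendsto_atTop.1 hg0 (η / 2) (by linarith)
    refine ⟨N + 1, fun y hy => ?_⟩
    rw [← hGi, dist_zero_right]
    have := intervalIntegral.norm_integral_le_of_norm_le_const (f := g) (C := η / 2)
      (a := y - 1 / 2) (b := y + 1 / 2) fun t ht => by
        rw [uIoc_of_le (by linarith)] at ht
        have := hN t (by linarith [ht.1])
        rw [dist_zero_right] at this
        exact this.le
    rw [show y + 1 / 2 - (y - 1 / 2) = 1 by ring, abs_one, mul_one] at this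
    linarith
  have hlim2 : Tendsto (fun y => f y - (G (y + 1 / 2) - G (y - 1 / 2))) atTop (𝓝 0) := by
    simpa using hf0.sub hlim
  have h0 : f x - (G (x + 1 / 2) - G (x - 1 / 2)) = 0 :=
    tendsto_nhds_unique (tendsto_const_nhds.congr fun y => (hconst y).symm) hlim2
  rw [hGi]; linarith

/-! ### A single solitary wave -/

/-- A solitary wave with `‖V‖₂ = 1 - δ`, that is, a single member of a high-energy family. By
evenness, unimodality is recorded on the half line `[0, ∞)` only. -/
structure SolitaryWave (m δ : ℝ) (V R : ℝ → ℝ) (σ : ℝ) : Prop where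
  pos : 0 < δ
  lt_one : δ < 1
  wave : IsTravellingWave m V R σ
  memLp_V : MemLp V 2 volume
  memLp_R : MemLp R 2 volume
  bc1_V : IsBC1 V
  nonneg_V : ∀ x, 0 ≤ V x
  even_V : ∀ x, V (-x) = V x
  even_R : ∀ x, R (-x) = R x
  anti_V : AntitoneOn V (Ici 0)
  anti_R : AntitoneOn R (Ici 0)
  norm_V : eLpNorm V 2 volume = ENNReal.ofReal (1 - δ)
  range_R : ∀ x, R x ∈ Ico (0 : ℝ) 1

lemma IsHighEnergyFamily.solitaryWave {V R : ℝ → ℝ → ℝ} {σ : ℝ → ℝ}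
    (h : IsHighEnergyFamily m V R σ) {δ : ℝ} (hδ : δ ∈ Ioo (0 : ℝ) 1) :
    SolitaryWave m δ (V δ) (R δ) (σ δ) where
  pos := hδ.1
  lt_one := hδ.2
  wave := h.wave δ hδ
  memLp_V := h.memLp_V δ hδ
  memLp_R := h.memLp_R δ hδ
  bc1_V := h.bc1_V δ hδ
  nonneg_V := h.nonneg_V δ hδ
  even_V := h.even_V δ hδ
  even_R := h.even_R δ hδ
  anti_V := (h.unimodal_V δ hδ).antitoneOn
  anti_R := (h.unimodal_R δ hδ).antitoneOn
  norm_V := h.norm_V δ hδ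
  range_R := h.range_R δ hδ

namespace SolitaryWave

variable {δ σ : ℝ} {V R : ℝ → ℝ}

lemma continuous_V (h : SolitaryWave m δ V R σ) : Continuous V := h.wave.diff_V.continuous

lemma continuous_R (h : SolitaryWave m δ V R σ) : Continuous R := h.wave.diff_R.continuous

lemma hasDerivAt_V (h : SolitaryWave m δ V R σ) (x : ℝ) : HasDerivAt V (deriv V x) x :=
  (h.wave.diff_V x).hasDerivAt

lemma continuous_deriv_V (h : SolitaryWave m δ V R σ) : Continuous (deriv V) :=
  h.bc1_V.contDiff.continuous_deriv le_rfl

lemma hasDerivAt_R (h : SolitaryWave m δ V R σ) (x : ℝ) : HasDerivAt R (deriv R x) x :=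
  (h.wave.diff_R x).hasDerivAt

lemma hasDerivAt_deriv_R (h : SolitaryWave m δ V R σ) (x : ℝ) :
    HasDerivAt (deriv R) (deriv V (x + 1 / 2) - deriv V (x - 1 / 2)) x := by
  rw [funext h.wave.eq_R]
  exact ((h.hasDerivAt_V _).comp_add_const x _).fun_sub ((h.hasDerivAt_V _).comp_sub_const x _)

lemma nonneg_R (h : SolitaryWave m δ V R σ) (x : ℝ) : 0 ≤ R x := (h.range_R x).1

lemma R_lt_one (h : SolitaryWave m δ V R σ) (x : ℝ) : R x < 1 := (h.range_R x).2

lemma speed_mul_deriv_V (hm : 1 < m) (h : SolitaryWave m δ V R σ) (x : ℝ) :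
    σ * deriv V x = stress m (R (x + 1 / 2)) - stress m (R (x - 1 / 2)) := by
  rw [h.wave.eq_V, (hasDerivAt_potential hm (h.R_lt_one _)).deriv,
    (hasDerivAt_potential hm (h.R_lt_one _)).deriv]

lemma continuous_stress (hm : 1 < m) (h : SolitaryWave m δ V R σ) :
    Continuous fun x => stress m (R x) :=
  continuous_iff_continuousAt.2 fun x =>
    ContinuousAt.comp (f := R) (g := stress m) (hasDerivAt_stress hm (h.R_lt_one x)).continuousAt
      h.continuous_R.continuousAt

lemma R_le_of_abs_le (h : SolitaryWave m δ V R σ) {x y : ℝ} (hxy : |x| ≤ |y|) : R y ≤ R x := by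
  have e : ∀ z, R |z| = R z := fun z => by
    rcases abs_choice z with hz | hz <;> rw [hz]
    exact h.even_R z
  rw [← e x, ← e y]
  exact h.anti_R (abs_nonneg x) (abs_nonneg y) hxy

lemma V_le_of_abs_le (h : SolitaryWave m δ V R σ) {x y : ℝ} (hxy : |x| ≤ |y|) : V y ≤ V x := by
  have e : ∀ z, V |z| = V z := fun z => by
    rcases abs_choice z with hz | hz <;> rw [hz]
    exact h.even_V z
  rw [← e x, ← e y]
  exact h.anti_V (abs_nonneg x) (abs_nonneg y) hxy

lemma integrable_V_sq (h : SolitaryWave m δ V R σ) : Integrable fun x => V x ^ 2 :=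
  h.memLp_V.integrable_sq

lemma integral_V_sq (h : SolitaryWave m δ V R σ) : ∫ x, V x ^ 2 = (1 - δ) ^ 2 := by
  have h1 := h.memLp_V.eLpNorm_eq_integral_rpow_norm two_ne_zero ENNReal.ofNat_ne_top
  rw [h.norm_V] at h1
  have hI : 0 ≤ ∫ x, V x ^ 2 := integral_nonneg fun x => sq_nonneg _
  have h2 : ∫ a, ‖V a‖ ^ (2 : ℝ≥0∞).toReal = ∫ x, V x ^ 2 := by
    congr 1; ext x
    simp
  rw [h2, ENNReal.ofReal_eq_ofReal_iff (by linarith [h.lt_one]) (rpow_nonneg hI _)] at h1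
  rw [h1, ← rpow_natCast, ← rpow_mul hI]
  simp

lemma tendsto_V (h : SolitaryWave m δ V R σ) : Tendsto V atTop (𝓝 0) :=
  tendsto_atTop_zero_of_antitoneOn_of_integrable_sq h.continuous_V h.nonneg_V h.anti_V
    h.integrable_V_sq

lemma tendsto_R (h : SolitaryWave m δ V R σ) : Tendsto R atTop (𝓝 0) :=
  tendsto_atTop_zero_of_antitoneOn_of_integrable_sq h.continuous_R h.nonneg_R h.anti_R
    h.memLp_R.integrable_sq

lemma R_eq_integral (h : SolitaryWave m δ V R σ) (x : ℝ) :
    R x = ∫ t in (x - 1 / 2)..(x + 1 / 2), V t :=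
  eq_integral_of_deriv_eq_sub h.continuous_V
    (fun y => by rw [← h.wave.eq_R]; exact h.hasDerivAt_R y) h.tendsto_R h.tendsto_V x

lemma speed_mul_V_eq_integral (hm : 1 < m) (h : SolitaryWave m δ V R σ) (x : ℝ) :
    σ * V x = ∫ t in (x - 1 / 2)..(x + 1 / 2), stress m (R t) := by
  refine eq_integral_of_deriv_eq_sub (f := fun x => σ * V x) (h.continuous_stress hm)
    (fun y => ?_) (by simpa using h.tendsto_V.const_mul σ) ?_ x
  · rw [← h.speed_mul_deriv_V hm]
    exact (h.hasDerivAt_V y).const_mul σ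
  · have := ((hasDerivAt_stress hm (r := 0) (by norm_num)).continuousAt.tendsto).comp h.tendsto_R
    simpa [stress_zero, Function.comp_def] using this

lemma integral_core (h : SolitaryWave m δ V R σ) :
    ∫ t in (-1 / 2 : ℝ)..(1 / 2), V t = R 0 := by
  rw [h.R_eq_integral 0]; norm_num

lemma integral_half_core (h : SolitaryWave m δ V R σ) :
    ∫ t in (0 : ℝ)..(1 / 2), V t = R 0 / 2 := by
  have h1 : ∫ t in (0 : ℝ)..(1 / 2), V (-t) = ∫ t in (-(1 / 2) : ℝ)..(-0), V t :=
    intervalIntegral.integral_comp_neg V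
  simp only [h.even_V, neg_zero] at h1
  have h2 := h.integral_core
  rw [← intervalIntegral.integral_add_adjacent_intervals
    (h.continuous_V.intervalIntegrable _ 0) (h.continuous_V.intervalIntegrable _ _)] at h2
  rw [neg_div, ← h1] at h2
  linarith

lemma intervalIntegral_V_sq_le (h : SolitaryWave m δ V R σ) {a b : ℝ} (hab : a ≤ b) :
    ∫ t in a..b, V t ^ 2 ≤ (1 - δ) ^ 2 := by
  rw [intervalIntegral.integral_of_le hab, ← h.integral_V_sq]
  exact setIntegral_le_integral h.integrable_V_sq (Eventually.of_forall fun t => sq_nonneg _)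

lemma R_zero_sq_le (h : SolitaryWave m δ V R σ) :
    R 0 ^ 2 ≤ ∫ t in (-1 / 2 : ℝ)..(1 / 2), V t ^ 2 := by
  have hc := h.continuous_V
  have h1 : 0 ≤ ∫ t in (-1 / 2 : ℝ)..(1 / 2), (V t - R 0) ^ 2 :=
    intervalIntegral.integral_nonneg (by norm_num) fun t _ => sq_nonneg _
  have h2 : ∫ t in (-1 / 2 : ℝ)..(1 / 2), (V t - R 0) ^ 2 =
      (∫ t in (-1 / 2 : ℝ)..(1 / 2), V t ^ 2) - 2 * R 0 * (∫ t in (-1 / 2 : ℝ)..(1 / 2), V t)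
        + R 0 ^ 2 := by
    have : ∀ t, (V t - R 0) ^ 2 = V t ^ 2 - 2 * R 0 * V t + R 0 ^ 2 := fun t => by ring
    simp only [this]
    rw [intervalIntegral.integral_add, intervalIntegral.integral_sub,
      intervalIntegral.integral_const_mul, intervalIntegral.integral_const]
    · norm_num
    all_goals exact Continuous.intervalIntegrable (by fun_prop) _ _
  rw [h2, h.integral_core] at h1
  linarith

/-- The Cauchy–Schwarz inequality on the core interval. -/
lemma R_zero_le (h : SolitaryWave m δ V R σ) : R 0 ≤ 1 - δ := by
  have h1 := h.R_zero_sq_le.trans (h.intervalIntegral_V_sq_le (by norm_num))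
  exact (le_abs_self _).trans (abs_le_of_sq_le_sq h1 (by linarith [h.lt_one]))

lemma R_half_bounds (h : SolitaryWave m δ V R σ) (hε : 1 - R 0 ≤ 1 / 12) :
    R 0 / 2 ≤ R (1 / 2) ∧ R (1 / 2) ≤ 3 / 4 := by
  have hc := h.continuous_V
  have h0 : R (1 / 2) = ∫ t in (0 : ℝ)..1, V t := by rw [h.R_eq_integral]; norm_num
  have h1 := intervalIntegral.integral_add_adjacent_intervals (μ := volume)
    (hc.intervalIntegrable 0 (1 / 2)) (hc.intervalIntegrable (1 / 2) 1)
  rw [h.integral_half_core] at h1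
  have hnn : 0 ≤ ∫ t in (1 / 2 : ℝ)..1, V t :=
    intervalIntegral.integral_nonneg (by norm_num) fun t _ => h.nonneg_V t
  have h2 : ∫ t in (1 / 2 : ℝ)..1, V t ≤ ∫ t in (1 / 2 : ℝ)..1, (V t ^ 2 + 1 / 4) :=
    intervalIntegral.integral_mono_on (by norm_num) (hc.intervalIntegrable _ _)
      (Continuous.intervalIntegrable (by fun_prop) _ _) fun t _ => by
        nlinarith [sq_nonneg (V t - 1 / 2)]
  rw [intervalIntegral.integral_add (Continuous.intervalIntegrable (by fun_prop) _ _)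
    (Continuous.intervalIntegrable (by fun_prop) _ _), intervalIntegral.integral_const] at h2
  have h3 := intervalIntegral.integral_add_adjacent_intervals (μ := volume)
    ((hc.pow 2).intervalIntegrable (-1 / 2) (1 / 2)) ((hc.pow 2).intervalIntegrable (1 / 2) 1)
  have h4 := h.intervalIntegral_V_sq_le (show (-1 / 2 : ℝ) ≤ 1 by norm_num)
  have h5 := h.R_zero_sq_le
  simp only [smul_eq_mul] at h2
  simp only [Pi.pow_apply] at h3
  have h6 : (1 - δ) ^ 2 ≤ 1 := by nlinarith [h.pos, h.lt_one]
  have h7 := h.R_lt_one 0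
  constructor
  · linarith
  · nlinarith

lemma R_le_three_quarters (h : SolitaryWave m δ V R σ) (hε : 1 - R 0 ≤ 1 / 12) {x : ℝ}
    (hx : 1 / 2 ≤ |x|) : R x ≤ 3 / 4 :=
  (h.R_le_of_abs_le (by rwa [abs_of_pos (by norm_num : (0 : ℝ) < 1 / 2)])).trans
    (h.R_half_bounds hε).2

lemma R_zero_le_V_zero (h : SolitaryWave m δ V R σ) : R 0 ≤ V 0 := by
  rw [← h.integral_core]
  have : ∫ t in (-1 / 2 : ℝ)..(1 / 2), V t ≤ ∫ t in (-1 / 2 : ℝ)..(1 / 2), V 0 :=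
    intervalIntegral.integral_mono_on (by norm_num) (h.continuous_V.intervalIntegrable _ _)
      (by simp) fun t _ => h.V_le_of_abs_le (by simp)
  rw [intervalIntegral.integral_const] at this
  norm_num at this
  linarith

/-- A crude upper bound for the speed. -/
lemma speed_le (hm : 1 < m) (h : SolitaryWave m δ V R σ) (hε : 1 - R 0 ≤ 1 / 12) :
    σ ≤ (1 - R 0) ^ (-(m + 1)) := by
  have h1 : σ * V 0 ≤ stress m (R 0) := by
    rw [h.speed_mul_V_eq_integral hm]
    have : ∫ t in (0 - 1 / 2 : ℝ)..(0 + 1 / 2), stress m (R t) ≤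
        ∫ t in (0 - 1 / 2 : ℝ)..(0 + 1 / 2), stress m (R 0) :=
      intervalIntegral.integral_mono_on (by norm_num)
        ((h.continuous_stress hm).intervalIntegrable _ _)
        (by simp) fun t _ => stress_mono hm (h.R_le_of_abs_le (by simp)) (h.R_lt_one 0)
    rw [intervalIntegral.integral_const] at this
    norm_num at this ⊢
    linarith
  have h2 := h.R_zero_le_V_zero
  have hp : 0 < (1 - R 0) ^ (-(m + 1)) := rpow_pos_of_pos (by linarith [h.R_lt_one 0]) _
  have h3 : stress m (R 0) ≤ 1 / 2 * (1 - R 0) ^ (-(m + 1)) := by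
    unfold stress
    have h4 : 1 / (m + 1) ≤ 1 / 2 := one_div_le_one_div_of_le (by norm_num) (by linarith)
    have h5 : 0 ≤ 1 / (m + 1) := by
      have : 0 < m + 1 := by linarith
      positivity
    nlinarith
  nlinarith [h.wave.speed_pos]

/-- The size `O(1 / σ)` of the forces that act outside of the tip region. -/
noncomputable def farForce (m σ : ℝ) : ℝ := stressBound m / σ

lemma farForce_pos (h : SolitaryWave m δ V R σ) : 0 < farForce m σ :=
  div_pos stressBound_pos h.wave.speed_pos

lemma V_le_farForce (hm : 1 < m) (h : SolitaryWave m δ V R σ) (hε : 1 - R 0 ≤ 1 / 12) {x : ℝ}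
    (hx : 1 ≤ x) : V x ≤ farForce m σ := by
  rw [farForce, le_div_iff₀ h.wave.speed_pos, mul_comm, h.speed_mul_V_eq_integral hm]
  have : ∫ t in (x - 1 / 2)..(x + 1 / 2), stress m (R t) ≤
      ∫ t in (x - 1 / 2)..(x + 1 / 2), stressBound m :=
    intervalIntegral.integral_mono_on (by linarith)
      ((h.continuous_stress hm).intervalIntegrable _ _) (by simp) fun t ht =>
        stress_le hm (h.nonneg_R t) (h.R_le_three_quarters hε (by
          rw [abs_of_nonneg (by linarith [ht.1])]; linarith [ht.1]))
  refine this.trans_eq ?_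
  rw [intervalIntegral.integral_const, smul_eq_mul]; ring

lemma R_le_V (h : SolitaryWave m δ V R σ) {x : ℝ} (hx : 1 / 2 ≤ x) : R x ≤ V (x - 1 / 2) := by
  rw [h.R_eq_integral]
  have : ∫ t in (x - 1 / 2)..(x + 1 / 2), V t ≤ ∫ t in (x - 1 / 2)..(x + 1 / 2), V (x - 1 / 2) :=
    intervalIntegral.integral_mono_on (by linarith) (h.continuous_V.intervalIntegrable _ _)
      (by simp) fun t ht => h.anti_V (show (0 : ℝ) ≤ _ by linarith)
        (show (0 : ℝ) ≤ _ by linarith [ht.1]) ht.1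
  refine this.trans_eq ?_
  rw [intervalIntegral.integral_const, smul_eq_mul]; ring

lemma V_le_farForce_mul (hm : 1 < m) (h : SolitaryWave m δ V R σ) (hε : 1 - R 0 ≤ 1 / 12) {x : ℝ}
    (hx : 1 ≤ x) : V x ≤ farForce m σ * V (x - 1) := by
  have hK := stressBound_pos (m := m)
  have h1 : σ * V x ≤ stressBound m * V (x - 1) := by
    rw [h.speed_mul_V_eq_integral hm]
    have : ∫ t in (x - 1 / 2)..(x + 1 / 2), stress m (R t) ≤
        ∫ t in (x - 1 / 2)..(x + 1 / 2), stressBound m * V (x - 1) :=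
      intervalIntegral.integral_mono_on (by linarith)
        ((h.continuous_stress hm).intervalIntegrable _ _) (by simp) fun t ht => by
          refine (stress_le_mul hm (h.nonneg_R t) (h.R_le_three_quarters hε (by
            rw [abs_of_nonneg (by linarith [ht.1])]; linarith [ht.1]))).trans ?_
          gcongr
          refine (h.anti_R (show (0 : ℝ) ≤ x - 1 / 2 by linarith)
            (show (0 : ℝ) ≤ _ by linarith [ht.1]) ht.1).trans ?_
          have := h.R_le_V (x := x - 1 / 2) (by linarith)
          rwa [show x - 1 / 2 - 1 / 2 = x - 1 by ring] at this
    refine this.trans_eq ?_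
    rw [intervalIntegral.integral_const, smul_eq_mul]; ring
  rw [farForce, div_mul_eq_mul_div, le_div_iff₀ h.wave.speed_pos]
  linarith

/-- The velocity profile decays geometrically, hence faster than `(1 + x²)⁻¹`. -/
lemma V_tail (hm : 1 < m) (h : SolitaryWave m δ V R σ) (hε : 1 - R 0 ≤ 1 / 12)
    (he : farForce m σ ≤ 1 / 2) {x : ℝ} (hx : 1 ≤ |x|) :
    V x ≤ 5 * farForce m σ * (1 + x ^ 2)⁻¹ := by
  wlog hx0 : 0 ≤ x generalizing x
  · have := this (x := -x) (by rwa [abs_neg]) (by linarith)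
    rwa [h.even_V, neg_sq] at this
  rw [abs_of_nonneg hx0] at hx
  have hgeo : ∀ n : ℕ, ∀ y : ℝ, 1 + n ≤ y → V y ≤ farForce m σ * (1 / 2) ^ n := by
    intro n
    induction n with
    | zero => intro y hy; simpa using h.V_le_farForce hm hε (by simpa using hy)
    | succ n ih =>
      intro y hy
      push_cast at hy
      have h0 : (0 : ℝ) ≤ n := n.cast_nonneg
      calc V y ≤ farForce m σ * V (y - 1) := h.V_le_farForce_mul hm hε (by linarith)
        _ ≤ 1 / 2 * (farForce m σ * (1 / 2) ^ n) :=
            mul_le_mul he (ih _ (by linarith)) (h.nonneg_V _) (by norm_num)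
        _ = _ := by ring
  have hquad : ∀ n : ℕ, 1 + ((n : ℝ) + 2) ^ 2 ≤ 5 * 2 ^ n := by
    intro n
    induction n with
    | zero => norm_num
    | succ n ih =>
      have h0 : (0 : ℝ) ≤ n := n.cast_nonneg
      push_cast
      rw [pow_succ (2 : ℝ)]
      nlinarith
  set n := ⌊x - 1⌋₊ with hn
  have hn1 : 1 + (n : ℝ) ≤ x := by linarith [Nat.floor_le (show 0 ≤ x - 1 by linarith)]
  have hn2 : x < n + 2 := by linarith [Nat.lt_floor_add_one (x - 1)]
  have hpos := h.farForce_pos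
  refine (hgeo n x hn1).trans ?_
  have h1 : (1 / 2 : ℝ) ^ n ≤ 5 * (1 + x ^ 2)⁻¹ := by
    rw [← div_eq_mul_inv, le_div_iff₀ (by positivity), one_div, inv_pow, ← div_eq_inv_mul,
      div_le_iff₀ (by positivity)]
    refine le_trans ?_ (hquad n)
    gcongr
  calc _ ≤ farForce m σ * (5 * (1 + x ^ 2)⁻¹) := by gcongr
    _ = _ := by ring

lemma R_tail (hm : 1 < m) (h : SolitaryWave m δ V R σ) (hε : 1 - R 0 ≤ 1 / 12)
    (he : farForce m σ ≤ 1 / 2) {x : ℝ} (hx : 3 / 2 ≤ |x|) :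
    R x ≤ 10 * farForce m σ * (1 + x ^ 2)⁻¹ := by
  wlog hx0 : 0 ≤ x generalizing x
  · have := this (x := -x) (by rwa [abs_neg]) (by linarith)
    rwa [h.even_R, neg_sq] at this
  rw [abs_of_nonneg hx0] at hx
  have h1 := h.R_le_V (x := x) (by linarith)
  have h2 := h.V_tail hm hε he (x := x - 1 / 2)
    (by rw [abs_of_nonneg (by linarith)]; linarith)
  have hpos := h.farForce_pos
  have h3 : (1 + (x - 1 / 2) ^ 2)⁻¹ ≤ 2 * (1 + x ^ 2)⁻¹ := by
    rw [← div_eq_mul_inv, inv_le_iff_one_le_mul₀ (by positivity), div_mul_eq_mul_div,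
      le_div_iff₀ (by positivity)]
    nlinarith [sq_nonneg (x - 1)]
  calc R x ≤ _ := h1
    _ ≤ _ := h2
    _ ≤ 5 * farForce m σ * (2 * (1 + x ^ 2)⁻¹) := by gcongr
    _ = _ := by ring

lemma stress_far (hm : 1 < m) (h : SolitaryWave m δ V R σ) (hε : 1 - R 0 ≤ 1 / 12) {x : ℝ}
    (hx : 1 / 2 ≤ |x|) : 0 ≤ stress m (R x) ∧ stress m (R x) ≤ stressBound m :=
  ⟨stress_nonneg hm (h.nonneg_R x) (h.R_lt_one x),
    stress_le hm (h.nonneg_R x) (h.R_le_three_quarters hε hx)⟩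

/-- The second order equation for the distance profile in terms of its nearest neighbours. -/
lemma speed_mul_second_deriv_R (hm : 1 < m) (h : SolitaryWave m δ V R σ) (x : ℝ) :
    σ * (deriv V (x + 1 / 2) - deriv V (x - 1 / 2)) =
      stress m (R (x + 1)) + stress m (R (x - 1)) - 2 * stress m (R x) := by
  rw [mul_sub, h.speed_mul_deriv_V hm, h.speed_mul_deriv_V hm]
  ring_nf

lemma abs_V_sub_deriv_R_le (hm : 1 < m) (h : SolitaryWave m δ V R σ) (hε : 1 - R 0 ≤ 1 / 12)
    {y : ℝ} (hy : y ∈ Icc (-1 / 2 : ℝ) (1 / 2)) :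
    |V (1 / 2 + y) - deriv R y / 2 + deriv R (1 / 2) / 2| ≤ 3 / 2 * farForce m σ := by
  have hσ := h.wave.speed_pos
  have hd : ∀ z ∈ Icc y (1 / 2), HasDerivAt (fun z => V (1 / 2 + z) - deriv R z / 2)
      (deriv V (1 / 2 + z) - (deriv V (z + 1 / 2) - deriv V (z - 1 / 2)) / 2) z := fun z _ =>
    ((h.hasDerivAt_V _).comp_const_add (1 / 2) z).fun_sub ((h.hasDerivAt_deriv_R z).div_const 2)
  have h1 := abs_sub_le_of_hasDerivAt_abs_le (K := 1 / 2 * farForce m σ) hy.2 hd fun z hz => by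
    have hz1 : -1 / 2 ≤ z := hy.1.trans hz.1
    have e : deriv V (1 / 2 + z) - (deriv V (z + 1 / 2) - deriv V (z - 1 / 2)) / 2 =
        (stress m (R (z + 1)) - stress m (R (z - 1))) / 2 / σ := by
      rw [eq_div_iff hσ.ne', add_comm (1 / 2) z]
      have h1 := h.speed_mul_deriv_V hm (z + 1 / 2)
      have h2 := h.speed_mul_second_deriv_R hm z
      rw [show z + 1 / 2 + 1 / 2 = z + 1 by ring, show z + 1 / 2 - 1 / 2 = z by ring] at h1
      linarith
    have h3 := h.stress_far hm hε (x := z + 1)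
      (by rw [abs_of_nonneg (by linarith)]; linarith)
    have h4 := h.stress_far hm hε (x := z - 1)
      (by rw [abs_of_nonpos (by linarith [hz.2])]; linarith [hz.2])
    rw [e, abs_div, abs_of_pos hσ, farForce, ← mul_div_assoc]
    gcongr
    rw [abs_le]
    constructor <;> linarith
  have h2 := h.V_le_farForce hm hε le_rfl
  have h3 := h.nonneg_V 1
  have h4 := h.farForce_pos
  have h5 : 1 / 2 * farForce m σ * (1 / 2 - y) ≤ 1 / 2 * farForce m σ := by
    refine mul_le_of_le_one_right (by positivity) (by linarith [hy.1])
  have h6 := abs_le.1 (h1.trans h5)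
  norm_num at h6
  norm_num
  rw [abs_le]
  constructor <;> linarith [h6.1, h6.2]

/-- The matching condition at `x = 1 / 2`. -/
lemma abs_deriv_R_half_add_le (hm : 1 < m) (h : SolitaryWave m δ V R σ)
    (hε : 1 - R 0 ≤ 1 / 12) : |deriv R (1 / 2) + 2 * R (1 / 2)| ≤ 3 * farForce m σ := by
  have hc := h.continuous_V
  set I : ℝ → ℝ := fun x => ∫ t in (0 : ℝ)..x, V t with hI
  have hId : ∀ x, HasDerivAt I (V x) x := fun x =>
    intervalIntegral.integral_hasDerivAt_right (hc.intervalIntegrable _ _)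
      (hc.stronglyMeasurableAtFilter _ _) hc.continuousAt
  have hd : ∀ z ∈ Icc (-1 / 2 : ℝ) (1 / 2), HasDerivAt
      (fun z => I (1 / 2 + z) - R z / 2 + deriv R (1 / 2) / 2 * z)
      (V (1 / 2 + z) - deriv R z / 2 + deriv R (1 / 2) / 2) z := fun z _ => by
    convert! (((hId _).comp_const_add (1 / 2) z).fun_sub ((h.hasDerivAt_R z).div_const 2)).fun_add
      ((hasDerivAt_id z).const_mul (deriv R (1 / 2) / 2)) using 1
    rw [mul_one]
  have h1 := abs_sub_le_of_hasDerivAt_abs_le (by norm_num) hd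
    fun z hz => h.abs_V_sub_deriv_R_le hm hε hz
  have h0 : R (1 / 2) = I 1 := by rw [h.R_eq_integral, hI]; norm_num
  have h00 : I 0 = 0 := by simp [hI]
  have h2 : R (-1 / 2) = R (1 / 2) := by rw [← h.even_R (1 / 2)]; norm_num
  rw [h2] at h1
  norm_num [h00] at h1
  norm_num at h0
  norm_num
  rw [h0] at h1 ⊢
  rw [abs_le] at h1 ⊢
  constructor <;> linarith [h1.1, h1.2]

lemma abs_V_transition_le (hm : 1 < m) (h : SolitaryWave m δ V R σ) (hε : 1 - R 0 ≤ 1 / 12)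
    {y : ℝ} (hy : y ∈ Icc (-1 / 2 : ℝ) (1 / 2)) :
    |V (1 / 2 + y) - (R (1 / 2) + deriv R y / 2)| ≤ 3 * farForce m σ := by
  have h1 := abs_le.1 (h.abs_V_sub_deriv_R_le hm hε hy)
  have h2 := abs_le.1 (h.abs_deriv_R_half_add_le hm hε)
  rw [abs_le]
  constructor <;> linarith [h1.1, h1.2, h2.1, h2.2]

lemma abs_R_foot_le (hm : 1 < m) (h : SolitaryWave m δ V R σ) (hε : 1 - R 0 ≤ 1 / 12)
    {y : ℝ} (hy : y ∈ Icc (-1 / 2 : ℝ) (1 / 2)) :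
    |R (1 + y) - (R (1 / 2) * (1 - y) - R y / 2)| ≤ 5 * farForce m σ := by
  have hd : ∀ z ∈ Icc y (1 / 2), HasDerivAt
      (fun z => R (1 + z) - (R (1 / 2) * (1 - z) - R z / 2))
      (deriv R (1 + z) - (R (1 / 2) * (-1) - deriv R z / 2)) z := fun z _ =>
    ((h.hasDerivAt_R _).comp_const_add 1 z).fun_sub
      ((((hasDerivAt_id z).const_sub 1).const_mul (R (1 / 2))).fun_sub
        ((h.hasDerivAt_R z).div_const 2))
  have h4 := h.farForce_pos
  have h1 := abs_sub_le_of_hasDerivAt_abs_le (K := 4 * farForce m σ) hy.2 hd fun z hz => by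
    have hz1 : -1 / 2 ≤ z := hy.1.trans hz.1
    have h1 := abs_le.1 (h.abs_V_transition_le hm hε ⟨hz1, hz.2⟩)
    have h2 := h.V_le_farForce hm hε (x := 1 + z + 1 / 2) (by linarith)
    have h3 := h.nonneg_V (1 + z + 1 / 2)
    rw [h.wave.eq_R, show 1 + z - 1 / 2 = 1 / 2 + z by ring, abs_le]
    constructor <;> linarith [h1.1, h1.2]
  have h5 : 4 * farForce m σ * (1 / 2 - y) ≤ 4 * farForce m σ := by
    refine mul_le_of_le_one_right (by positivity) (by linarith [hy.1])
  have h6 := abs_le.1 (h1.trans h5)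
  have h7 := h.R_le_V (x := 3 / 2) (by norm_num)
  have h8 := h.V_le_farForce hm hε le_rfl
  have h9 := h.nonneg_R (3 / 2)
  norm_num at h6 h7
  norm_num
  rw [abs_le]
  constructor <;> linarith [h6.1, h6.2]

end SolitaryWave

/-! ### The tip scaling -/

/-- The constant in the deviation of the rescaled wave from the tip profile. -/
noncomputable def tipError (m : ℝ) : ℝ :=
  exp (2 * (tipSlope m / 2) ^ (-(m + 2))) * (1 + 2 * stressBound m) / tipSlope m ^ 2

lemma tipError_pos (hm : 1 < m) : 0 < tipError m := by
  have := tipSlope_pos hm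
  have := stressBound_pos (m := m)
  unfold tipError; positivity

namespace SolitaryWave

variable {δ σ ε X : ℝ} {V R S : ℝ → ℝ}

lemma amplitude_pos (h : SolitaryWave m δ V R σ) (hε : R 0 = 1 - ε) : 0 < ε := by
  linarith [h.R_lt_one 0]

lemma hasDerivAt_scaled (h : SolitaryWave m δ V R σ) (ε X x : ℝ) :
    HasDerivAt (fun x => (1 - ε - R (x / (2 * X))) / ε)
      (-(deriv R (x / (2 * X)) * (1 / (2 * X))) / ε) x := by
  have h1 : HasDerivAt (fun x => R (x / (2 * X))) (deriv R (x / (2 * X)) * (1 / (2 * X))) x :=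
    (h.hasDerivAt_R _).comp x ((hasDerivAt_id x).div_const (2 * X))
  exact (h1.const_sub (1 - ε)).div_const ε

lemma hasDerivAt_deriv_scaled (h : SolitaryWave m δ V R σ) (ε X x : ℝ) :
    HasDerivAt (fun x => -(deriv R (x / (2 * X)) * (1 / (2 * X))) / ε)
      (-((deriv V (x / (2 * X) + 1 / 2) - deriv V (x / (2 * X) - 1 / 2)) * (1 / (2 * X))
        * (1 / (2 * X))) / ε) x := by
  have h1 : HasDerivAt (fun x => deriv R (x / (2 * X)))
      ((deriv V (x / (2 * X) + 1 / 2) - deriv V (x / (2 * X) - 1 / 2)) * (1 / (2 * X))) x :=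
    (h.hasDerivAt_deriv_R _).comp x ((hasDerivAt_id x).div_const (2 * X))
  exact (h1.mul_const _).neg.div_const ε

/-- In the tip scaling the wave is a convex solution of the tip equation up to `O(ε ^ (m + 1))`. -/
lemma scaled_tip_equation (hm : 1 < m) (h : SolitaryWave m δ V R σ) (hε : R 0 = 1 - ε)
    (hε1 : ε ≤ 1 / 12) (hX : 0 < X) (hXσ : 4 * X ^ 2 * (σ * ε ^ (m + 2)) = 1) {x : ℝ}
    (hx : x ∈ Icc 0 X) :
    0 ≤ -((deriv V (x / (2 * X) + 1 / 2) - deriv V (x / (2 * X) - 1 / 2)) * (1 / (2 * X))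
        * (1 / (2 * X))) / ε ∧
    |-((deriv V (x / (2 * X) + 1 / 2) - deriv V (x / (2 * X) - 1 / 2)) * (1 / (2 * X))
        * (1 / (2 * X))) / ε - tipForce m ((1 - ε - R (x / (2 * X))) / ε)| ≤
      (1 + 2 * stressBound m) * ε ^ (m + 1) := by
  have hε0 := h.amplitude_pos hε
  have hε1' : 1 - R 0 ≤ 1 / 12 := by linarith
  have hσ := h.wave.speed_pos
  set y := x / (2 * X) with hy
  have hy0 : 0 ≤ y := div_nonneg hx.1 (by linarith)
  have hy1 : y ≤ 1 / 2 := by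
    rw [hy, div_le_iff₀ (by linarith)]; linarith [hx.2]
  have hsp := h.stress_far hm hε1' (x := y + 1) (by rw [abs_of_nonneg (by linarith)]; linarith)
  have hsm := h.stress_far hm hε1' (x := y - 1) (by rw [abs_of_nonpos (by linarith)]; linarith)
  have hp1 := stress_mono hm (h.R_le_of_abs_le (x := y) (y := y + 1)
    (by rw [abs_of_nonneg hy0, abs_of_nonneg (by linarith)]; linarith)) (h.R_lt_one y)
  have hm1 := stress_mono hm (h.R_le_of_abs_le (x := y) (y := y - 1)
    (by rw [abs_of_nonneg hy0, abs_of_nonpos (by linarith)]; linarith)) (h.R_lt_one y)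
  have hE : 0 < ε ^ (m + 1) := rpow_pos_of_pos hε0 _
  have hw : -((deriv V (y + 1 / 2) - deriv V (y - 1 / 2)) * (1 / (2 * X))
        * (1 / (2 * X))) / ε =
      ε ^ (m + 1) * (2 * stress m (R y) - stress m (R (y + 1)) - stress m (R (y - 1))) := by
    have h1 := h.speed_mul_second_deriv_R hm y
    have h2 : ε ^ (m + 2) = ε ^ (m + 1) * ε := by
      rw [show m + 2 = (m + 1) + 1 by ring, rpow_add hε0, rpow_one]
    have h3 : 1 / (2 * X) * (1 / (2 * X)) = σ * (ε ^ (m + 1) * ε) := by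
      rw [← h2]; field_simp; linarith
    calc _ = -((deriv V (y + 1 / 2) - deriv V (y - 1 / 2)) *
            (1 / (2 * X) * (1 / (2 * X)))) / ε := by ring
      _ = ε ^ (m + 1) * -(σ * (deriv V (y + 1 / 2) - deriv V (y - 1 / 2))) := by
          rw [h3]; field_simp
      _ = _ := by rw [h1]; ring
  have hF : tipForce m ((1 - ε - R y) / ε) =
      ε ^ (m + 1) * (2 * stress m (R y) + 2 / (m + 1)) := by
    have h1 : 1 + (1 - ε - R y) / ε = (1 - R y) / ε := by field_simp; ring
    have h2 : 0 < 1 - R y := by linarith [h.R_lt_one y]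
    have h3 : 0 < (1 - R y) / ε := by positivity
    rw [tipForce_eq (by linarith), h1, div_rpow h2.le hε0.le, rpow_neg hε0.le, stress]
    have : m + 1 ≠ 0 := by linarith
    field_simp
    ring
  have hm2 : 2 / (m + 1) ≤ 1 := by rw [div_le_one (by linarith)]; linarith
  have hm3 : 0 < 2 / (m + 1) := div_pos two_pos (by linarith)
  rw [hw, hF, ← mul_sub, abs_mul, abs_of_pos hE, mul_comm _ (ε ^ (m + 1))]
  refine ⟨mul_nonneg hE.le (by linarith), ?_⟩
  gcongr
  rw [abs_le]
  constructor <;> linarith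

/-- The length scale of the tip is of order `ε`, and on this scale the wave is close to the tip
profile. Here `1 / (2 X)` is the scaling parameter of the tip. -/
lemma exists_scale (hm : 1 < m) (hS : IsTipProfile m S) (h : SolitaryWave m δ V R σ)
    (hε : R 0 = 1 - ε) (hε1 : ε ≤ 1 / 12) (hε2 : (1 + 2 * stressBound m) * ε ≤ tipSlope m) :
    ∃ X, 1 ≤ X ∧ 4 * X ^ 2 * (σ * ε ^ (m + 2)) = 1 ∧ X * ε ≤ 1 / tipSlope m ∧
      ∀ y ∈ Icc (0 : ℝ) (1 / 2),
        |R y - (1 - ε - ε * S (2 * X * y))| ≤ tipError m * ε ^ m ∧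
        |deriv R y + 2 * X * ε * deriv S (2 * X * y)| ≤
          2 * tipError m * ε ^ m := by
  have hε0 := h.amplitude_pos hε
  have hε1' : 1 - R 0 ≤ 1 / 12 := by linarith
  have hσ := h.wave.speed_pos
  have hc := tipSlope_pos hm
  have hc' := tipSlope_le_half hm
  have hK := stressBound_pos (m := m)
  have hE : 0 < ε ^ (m + 2) := rpow_pos_of_pos hε0 _
  set μ := √(σ * ε ^ (m + 2)) with hμ
  have hμ0 : 0 < μ := sqrt_pos.2 (by positivity)
  have hμ2 : μ ^ 2 = σ * ε ^ (m + 2) := sq_sqrt (by positivity)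
  have hμle : μ ≤ 1 / 2 := by
    have h1 := h.speed_le hm hε1'
    rw [hε, sub_sub_cancel] at h1
    have h2 : σ * ε ^ (m + 2) ≤ ε := by
      calc σ * ε ^ (m + 2) ≤ ε ^ (-(m + 1)) * ε ^ (m + 2) := by gcongr
        _ = ε := by rw [← rpow_add hε0]; norm_num
    nlinarith
  set X := 1 / (2 * μ) with hX
  have hX1 : 1 ≤ X := by rw [hX, le_div_iff₀ (by linarith)]; linarith
  have hX0 : 0 < X := by linarith
  have hXσ : 4 * X ^ 2 * (σ * ε ^ (m + 2)) = 1 := by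
    rw [← hμ2, hX]; field_simp; norm_num
  have hf : (1 + 2 * stressBound m) * ε ^ (m + 1) ≤ tipSlope m := by
    refine le_trans ?_ hε2
    gcongr
    calc ε ^ (m + 1) ≤ ε ^ (1 : ℝ) :=
          rpow_le_rpow_of_exponent_ge hε0 (by linarith) (by linarith)
      _ = ε := rpow_one _
  set T : ℝ → ℝ := fun x => (1 - ε - R (x / (2 * X))) / ε with hT
  have hT0 : T 0 = 0 := by simp [hT, hε]
  have hR0 : deriv R 0 = 0 := by
    rw [h.wave.eq_R]
    have := h.even_V (1 / 2)
    norm_num at this ⊢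
    linarith
  have hwc : Continuous fun x => -((deriv V (x / (2 * X) + 1 / 2) - deriv V (x / (2 * X) - 1 / 2))
      * (1 / (2 * X)) * (1 / (2 * X))) / ε := by
    have := h.continuous_deriv_V
    fun_prop
  have heq := fun x hx => h.scaled_tip_equation hm hε hε1 hX0 hXσ (x := x) hx
  have hgrowth := one_add_ge_of_second_deriv hm hX1 (h.hasDerivAt_scaled ε X)
    (h.hasDerivAt_deriv_scaled ε X) hT0 (by simp [hR0]) hf
    (fun x hx => (heq x hx).1) (fun x hx => (heq x hx).2) X ⟨hX0.le, le_rfl⟩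
  have hcomp := hS.abs_sub_le_of_approx hm hX1 (h.hasDerivAt_scaled ε X)
    (h.hasDerivAt_deriv_scaled ε X) hwc hT0 (by simp [hR0]) (by positivity) hf
    (fun x hx => (heq x hx).1) (fun x hx => (heq x hx).2)
  have hXhalf : X / (2 * X) = 1 / 2 := by field_simp
  have hXε : X * ε ≤ 1 / tipSlope m := by
    -- linear growth of the rescaled profile up to `R (1 / 2) ≥ R 0 / 2` limits the length `X`
    have h1 := hgrowth.2.1
    rw [hXhalf, le_div_iff₀ hε0] at h1
    have h2 := (h.R_half_bounds hε1').1
    rw [le_div_iff₀ hc]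
    nlinarith
  refine ⟨X, hX1, hXσ, hXε, fun y hy => ?_⟩
  have hx : 2 * X * y ∈ Icc 0 X := ⟨mul_nonneg (by linarith) hy.1, by nlinarith [hy.2]⟩
  have hxy : 2 * X * y / (2 * X) = y := by field_simp
  obtain ⟨h1, h2⟩ := hcomp _ hx
  rw [hxy] at h1 h2
  have hEm : 0 < ε ^ m := rpow_pos_of_pos hε0 _
  have hE1 : ε ^ (m + 1) = ε ^ m * ε := by rw [rpow_add hε0, rpow_one]
  set G := exp (2 * (tipSlope m / 2) ^ (-(m + 2))) with hG
  have hG0 : 0 < G := exp_pos _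
  have hxε : 2 * X * y * ε ≤ 1 / tipSlope m :=
    le_trans (mul_le_mul_of_nonneg_right hx.2 hε0.le) hXε
  have hxε0 : 0 ≤ 2 * X * y * ε := mul_nonneg hx.1 hε0.le
  have hb : tipError m = G * (1 + 2 * stressBound m) * (1 / tipSlope m) ^ 2 := by
    rw [tipError, ← hG]; field_simp
  constructor
  · have e : R y - (1 - ε - ε * S (2 * X * y)) = -(ε * ((1 - ε - R y) / ε - S (2 * X * y))) := by
      field_simp; ring
    rw [e, abs_neg, abs_mul, abs_of_pos hε0, hb]
    calc _ ≤ ε * (G * ((1 + 2 * stressBound m) * ε ^ (m + 1)) * (2 * X * y) ^ 2) := by gcongr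
      _ = G * (1 + 2 * stressBound m) * (2 * X * y * ε) ^ 2 * ε ^ m := by rw [hE1]; ring
      _ ≤ _ := by gcongr
  · have e : deriv R y + 2 * X * ε * deriv S (2 * X * y) =
        -(2 * X * ε * (-(deriv R y * (1 / (2 * X))) / ε - deriv S (2 * X * y))) := by
      field_simp; ring
    rw [e, abs_neg, abs_mul, abs_of_pos (by positivity), hb]
    calc _ ≤ 2 * X * ε * (G * ((1 + 2 * stressBound m) * ε ^ (m + 1)) * (2 * X * y)) := by gcongr
      _ = 2 * (G * (1 + 2 * stressBound m) * ((2 * X * y * ε) * (X * ε))) * ε ^ m := by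
        rw [hE1]; ring
      _ ≤ 2 * (G * (1 + 2 * stressBound m) * (1 / tipSlope m * (1 / tipSlope m))) * ε ^ m := by
        gcongr
      _ = _ := by ring

end SolitaryWave

/-- `P_ε = 1 + ε (κ̄ - 1)`, so that `μ̂_ε = μ̄ ε / P_ε`. -/
noncomputable def slopeHat (S : ℝ → ℝ) (ε : ℝ) : ℝ := 1 + ε * (kappaBar S - 1)

lemma slopeHat_ge (hm : 1 < m) {S : ℝ → ℝ} (hS : IsTipProfile m S) {ε : ℝ} (hε0 : 0 < ε)
    (hε1 : ε ≤ 1 / 12) : 1 / 2 ≤ slopeHat S ε := by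
  have := mul_nonneg hε0.le (hS.kappaBar_nonneg hm)
  unfold slopeHat; linarith

lemma slopeHat_le (hm : 1 < m) {S : ℝ → ℝ} (hS : IsTipProfile m S) {ε : ℝ} (hε0 : 0 < ε)
    (hε1 : ε ≤ 1 / 12) : slopeHat S ε ≤ 1 + kappaBar S := by
  have := hS.kappaBar_nonneg hm
  unfold slopeHat; nlinarith

/-- `ε / μ̂_ε = P_ε / μ̄`. -/
lemma div_muHat (hm : 1 < m) {S : ℝ → ℝ} (hS : IsTipProfile m S) {ε : ℝ} (hε0 : 0 < ε)
    (hε1 : ε ≤ 1 / 12) : ε / muHat m S ε = slopeHat S ε / muBar m := by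
  have h1 := slopeHat_ge hm hS hε0 hε1
  have h2 := muBar_pos hm
  unfold slopeHat at *
  rw [muHat]
  have : (1 + ε * (kappaBar S - 1)) ≠ 0 := by linarith
  field_simp

lemma muHat_pos (hm : 1 < m) {S : ℝ → ℝ} (hS : IsTipProfile m S) {ε : ℝ} (hε0 : 0 < ε)
    (hε1 : ε ≤ 1 / 12) : 0 < muHat m S ε := by
  have h1 := slopeHat_ge hm hS hε0 hε1
  have h2 := muBar_pos hm
  unfold slopeHat at h1
  exact div_pos (by positivity) (by linarith)

namespace SolitaryWave

variable {δ σ ε X : ℝ} {V R S : ℝ → ℝ}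

lemma scale_ge (hm : 1 < m) (hS : IsTipProfile m S) (h : SolitaryWave m δ V R σ)
    (hε : R 0 = 1 - ε) (hε1 : ε ≤ 1 / 12) (hε3 : tipError m * ε ≤ 1 / 12) (hX : 1 ≤ X)
    (hR : |R (1 / 2) - (1 - ε - ε * S X)| ≤ tipError m * ε ^ m) :
    1 / (12 * muBar m) ≤ X * ε := by
  have hε0 := h.amplitude_pos hε
  have hμ := muBar_pos hm
  have h1 := (h.R_half_bounds (by linarith)).2
  have h2 := (abs_le.1 hR).1
  have h3 := mul_le_mul_of_nonneg_left (hS.le_muBar_mul hm (by linarith : 0 ≤ X)) hε0.le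
  have h4 : tipError m * ε ^ m ≤ tipError m * ε := by
    have := tipError_pos hm
    gcongr
    calc ε ^ m ≤ ε ^ (1 : ℝ) := rpow_le_rpow_of_exponent_ge hε0 (by linarith) hm.le
      _ = ε := rpow_one _
  rw [div_le_iff₀ (by positivity)]
  nlinarith

/-- The constant in `abs_slopeHat_sub_le`. -/
noncomputable def slopeError (m : ℝ) : ℝ :=
  3 / 2 * (4 * stressBound m / tipSlope m ^ 2) + 2 * tipError m + tipError m
    + (IsTipProfile.kappaRate m + 2 * (muBar m * (tipSlope m / 2) ^ (-m))) *
      (1 / (12 * muBar m)) ^ (1 - m)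

lemma slopeError_pos (hm : 1 < m) : 0 < slopeError m := by
  have h1 := tipSlope_pos hm
  have h2 := tipError_pos hm
  have h3 := muBar_pos hm
  have h4 := stressBound_pos (m := m)
  have h5 : 0 < m - 1 := by linarith
  unfold slopeError IsTipProfile.kappaRate
  positivity

lemma farForce_le (hm : 1 < m) (h : SolitaryWave m δ V R σ)
    (hε : R 0 = 1 - ε) (hX0 : 0 < X) (hXσ : 4 * X ^ 2 * (σ * ε ^ (m + 2)) = 1)
    (hXε : X * ε ≤ 1 / tipSlope m) :
    farForce m σ ≤ 4 * stressBound m / tipSlope m ^ 2 * ε ^ m := by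
  have hε0 := h.amplitude_pos hε
  have hσ := h.wave.speed_pos
  have hK := stressBound_pos (m := m)
  have hc := tipSlope_pos hm
  have hEm : 0 < ε ^ m := rpow_pos_of_pos hε0 _
  have hE2 : ε ^ (m + 2) = ε ^ m * ε ^ 2 := by
    rw [rpow_add hε0]; norm_num
  rw [hE2] at hXσ
  have h1 : 1 / σ = 4 * (X * ε) ^ 2 * ε ^ m := by
    rw [div_eq_iff hσ.ne', ← hXσ]; ring
  calc farForce m σ = stressBound m * (1 / σ) := by rw [farForce]; ring
    _ = stressBound m * (4 * (X * ε) ^ 2 * ε ^ m) := by rw [h1]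
    _ ≤ stressBound m * (4 * (1 / tipSlope m) ^ 2 * ε ^ m) := by gcongr
    _ = _ := by field_simp

/-- The matching condition determines the scaling parameter up to a relative error `O(ε ^ m)`, and
with it the value of the distance profile at `1 / 2`. -/
lemma abs_slopeHat_sub_le (hm : 1 < m) (hS : IsTipProfile m S) (h : SolitaryWave m δ V R σ)
    (hε : R 0 = 1 - ε) (hε1 : ε ≤ 1 / 12) (hX : 1 ≤ X)
    (hXσ : 4 * X ^ 2 * (σ * ε ^ (m + 2)) = 1)
    (hXε : X * ε ≤ 1 / tipSlope m) (hXε' : 1 / (12 * muBar m) ≤ X * ε)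
    (hR : |R (1 / 2) - (1 - ε - ε * S X)| ≤ tipError m * ε ^ m)
    (hR' : |deriv R (1 / 2) + 2 * X * ε * deriv S X| ≤
          2 * tipError m * ε ^ m) :
    |slopeHat S ε - 2 * X * ε * muBar m| ≤ slopeError m * ε ^ m ∧
      |R (1 / 2) - slopeHat S ε / 2| ≤ slopeError m * ε ^ m := by
  have hε0 := h.amplitude_pos hε
  have hX0 : 0 < X := by linarith
  have hμ := muBar_pos hm
  have hc := tipSlope_pos hm
  have hEm : 0 < ε ^ m := rpow_pos_of_pos hε0 _
  have h1 := abs_le.1 ((h.abs_deriv_R_half_add_le hm (by linarith)).trans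
    (mul_le_mul_of_nonneg_left (h.farForce_le hm hε hX0 hXσ hXε) (by norm_num)))
  have hR := abs_le.1 hR
  have hR' := abs_le.1 hR'
  obtain ⟨k1, k2⟩ := (hS.kappaBar_spec hm).2 X hX0.le
  have s1 := hS.deriv_le_muBar hm X
  have s2 := hS.muBar_sub_deriv_le hm hX0.le
  set A := muBar m * (tipSlope m / 2) ^ (-m) with hA
  have hA0 : 0 < A := by positivity
  have hpow : (1 + X) ^ (1 - m) * ε ≤ (1 / (12 * muBar m)) ^ (1 - m) * ε ^ m := by
    have e : ε = ε ^ (1 - m) * ε ^ m := by rw [← rpow_add hε0]; simp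
    calc (1 + X) ^ (1 - m) * ε = (1 + X) ^ (1 - m) * (ε ^ (1 - m) * ε ^ m) := by rw [← e]
      _ = ((1 + X) * ε) ^ (1 - m) * ε ^ m := by
        rw [mul_rpow (by linarith) hε0.le]; ring
      _ ≤ _ := by
        gcongr 1
        exact rpow_le_rpow_of_nonpos (by positivity) (by nlinarith) (by linarith)
  have hkr : 0 < IsTipProfile.kappaRate m := by
    have : 0 < m - 1 := by linarith
    unfold IsTipProfile.kappaRate; positivity
  have t1 : 0 ≤ ε * (kappaBar S - (X * deriv S X - S X)) := mul_nonneg hε0.le (by linarith)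
  have t2 : ε * (kappaBar S - (X * deriv S X - S X)) ≤
      IsTipProfile.kappaRate m * (1 / (12 * muBar m)) ^ (1 - m) * ε ^ m := by
    calc _ ≤ ε * (IsTipProfile.kappaRate m * (1 + X) ^ (1 - m)) := by gcongr
      _ = IsTipProfile.kappaRate m * ((1 + X) ^ (1 - m) * ε) := by ring
      _ ≤ IsTipProfile.kappaRate m * ((1 / (12 * muBar m)) ^ (1 - m) * ε ^ m) := by gcongr
      _ = _ := by ring
  have t3 : 0 ≤ 2 * X * ε * (muBar m - deriv S X) :=
    mul_nonneg (by positivity) (by linarith)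
  have t4 : 2 * X * ε * (muBar m - deriv S X) ≤
      2 * A * (1 / (12 * muBar m)) ^ (1 - m) * ε ^ m := by
    calc _ ≤ 2 * X * ε * (A * (1 + X) ^ (-m)) := by gcongr
      _ ≤ 2 * (1 + X) * ε * (A * (1 + X) ^ (-m)) := by gcongr; linarith
      _ = 2 * A * (((1 + X) ^ (1 : ℝ) * (1 + X) ^ (-m)) * ε) := by rw [rpow_one]; ring
      _ = 2 * A * ((1 + X) ^ (1 - m) * ε) := by
        rw [← rpow_add (by linarith), ← sub_eq_add_neg]
      _ ≤ 2 * A * ((1 / (12 * muBar m)) ^ (1 - m) * ε ^ m) := by gcongr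
      _ = _ := by ring
  have q1 : 0 ≤ tipError m * ε ^ m := mul_nonneg (tipError_pos hm).le hEm.le
  have q2 : 0 ≤ 2 * tipError m * ε ^ m := by
    have := tipError_pos hm
    positivity
  have q3 : 0 ≤ 4 * stressBound m / tipSlope m ^ 2 * ε ^ m := by
    have := stressBound_pos (m := m)
    positivity
  have e1 : slopeError m * ε ^ m = 3 / 2 * (4 * stressBound m / tipSlope m ^ 2 * ε ^ m)
      + 2 * tipError m * ε ^ m + tipError m * ε ^ m
      + IsTipProfile.kappaRate m * (1 / (12 * muBar m)) ^ (1 - m) * ε ^ m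
      + 2 * A * (1 / (12 * muBar m)) ^ (1 - m) * ε ^ m := by
    rw [slopeError, ← hA]; ring
  rw [e1]
  have e2 : slopeHat S ε - 2 * X * ε * muBar m =
      (1 / 2 * (deriv R (1 / 2) + 2 * R (1 / 2)))
      - 1 / 2 * (deriv R (1 / 2) + 2 * X * ε * deriv S X)
      - (R (1 / 2) - (1 - ε - ε * S X))
      + ε * (kappaBar S - (X * deriv S X - S X))
      - 2 * X * ε * (muBar m - deriv S X) := by
    rw [slopeHat]; ring
  have e3 : R (1 / 2) - slopeHat S ε / 2 =
      1 / 4 * (deriv R (1 / 2) + 2 * R (1 / 2))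
      - 1 / 4 * (deriv R (1 / 2) + 2 * X * ε * deriv S X)
      + 1 / 2 * (R (1 / 2) - (1 - ε - ε * S X))
      - 1 / 2 * (ε * (kappaBar S - (X * deriv S X - S X))) := by
    rw [slopeHat]; ring
  rw [e2, e3, abs_le, abs_le]
  refine ⟨⟨?_, ?_⟩, ?_, ?_⟩ <;> linarith [h1.1, h1.2, hR.1, hR.2, hR'.1, hR'.2]

end SolitaryWave

/-! ### Approximation of a single wave -/

namespace IsTipProfile

variable {S : ℝ → ℝ}

lemma abs_sub_le (hm : 1 < m) (hS : IsTipProfile m S) {a b : ℝ} (ha : 0 ≤ a) (hb : 0 ≤ b) :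
    |S a - S b| ≤ muBar m * |a - b| := by
  wlog hab : b ≤ a generalizing a b
  · rw [abs_sub_comm, abs_sub_comm a]
    exact this hb ha (le_of_not_ge hab)
  rw [abs_of_nonneg (sub_nonneg.2 hab)]
  refine abs_sub_le_of_hasDerivAt_abs_le hab (fun y _ => hS.hasDerivAt y) fun y hy => ?_
  rw [abs_of_nonneg (hS.deriv_nonneg hm (hb.trans hy.1))]
  exact hS.deriv_le_muBar hm y

lemma abs_mul_deriv_sub_le (hm : 1 < m) (hS : IsTipProfile m S) {a b y : ℝ} (ha : 0 ≤ a)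
    (hb : 0 ≤ b) (hy : 0 ≤ y) :
    |a * deriv S (a * y) - b * deriv S (b * y)| ≤
      (muBar m + (tipSlope m / 2) ^ (-(m + 1))) * |a - b| := by
  wlog hab : b ≤ a generalizing a b
  · rw [abs_sub_comm, abs_sub_comm a]
    exact this hb ha (le_of_not_ge hab)
  rw [abs_of_nonneg (sub_nonneg.2 hab)]
  have hd : ∀ z ∈ Icc b a, HasDerivAt (fun z => z * deriv S (z * y))
      (1 * deriv S (z * y) + z * (tipForce m (S (z * y)) * (1 * y))) z := fun z _ => by
    have h0 : HasDerivAt (fun z => z * y) (1 * y) z := (hasDerivAt_id z).mul_const y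
    have h1 : HasDerivAt (fun z => deriv S (z * y)) (tipForce m (S (z * y)) * (1 * y)) z :=
      HasDerivAt.comp (h₂ := deriv S) (h := fun z => z * y) z (hS.hasDerivAt_deriv (z * y)) h0
    exact (hasDerivAt_id z).mul h1
  refine abs_sub_le_of_hasDerivAt_abs_le hab hd fun z hz => ?_
  have hz0 : 0 ≤ z := hb.trans hz.1
  have hzy : 0 ≤ z * y := mul_nonneg hz0 hy
  have h1 := hS.deriv_nonneg hm hzy
  have h2 := hS.deriv_le_muBar hm (z * y)
  have h3 := hS.mul_tipForce_le' hm hzy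
  have h4 := mul_nonneg hzy (tipForce_pos hm (hS.gt_neg_one (z * y))).le
  have e : 1 * deriv S (z * y) + z * (tipForce m (S (z * y)) * (1 * y)) =
      deriv S (z * y) + z * y * tipForce m (S (z * y)) := by ring
  rw [e, abs_of_nonneg (by linarith)]
  linarith

end IsTipProfile

lemma eventually_mul_le {C a : ℝ} (ha : 0 < a) : ∀ᶠ ε : ℝ in 𝓝[>] 0, C * ε ≤ a := by
  have h : Tendsto (fun ε : ℝ => C * ε) (𝓝[>] 0) (𝓝 0) := by
    have : Tendsto (fun ε : ℝ => C * ε) (𝓝 0) (𝓝 (C * 0)) := tendsto_id.const_mul C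
    rw [mul_zero] at this
    exact this.mono_left nhdsWithin_le_nhds
  exact h.eventually (ge_mem_nhds ha)

namespace SolitaryWave

variable {δ σ : ℝ} {V R S : ℝ → ℝ}

lemma deriv_R_odd (h : SolitaryWave m δ V R σ) (x : ℝ) : deriv R (-x) = -deriv R x := by
  rw [h.wave.eq_R, h.wave.eq_R, ← h.even_V (-x + 1 / 2), ← h.even_V (-x - 1 / 2)]
  ring_nf

end SolitaryWave

/-- The core approximation result: on the core interval `R` and `R'` agree with the rescaled tip
profile up to `O(ε ^ m)`, uniformly over all solitary waves of amplitude `1 - ε`. -/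
lemma exists_core_approximation (hm : 1 < m) {S : ℝ → ℝ} (hS : IsTipProfile m S) :
    ∃ C, 0 < C ∧ ∀ᶠ ε in 𝓝[>] (0 : ℝ), ε ≤ 1 / 12 ∧ ∀ (δ : ℝ) (V R : ℝ → ℝ) (σ : ℝ),
      SolitaryWave m δ V R σ → R 0 = 1 - ε →
      SolitaryWave.farForce m σ ≤ C * ε ^ m ∧ SolitaryWave.farForce m σ ≤ 1 / 2 ∧
      |σ - sigmaHat m S ε| ≤ C ∧ |R (1 / 2) - slopeHat S ε / 2| ≤ C * ε ^ m ∧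
      ∀ y ∈ Icc (-1 / 2 : ℝ) (1 / 2),
        |R y - (1 - ε - ε * S (y / muHat m S ε))| ≤ C * ε ^ m ∧
        |deriv R y + ε / muHat m S ε * deriv S (y / muHat m S ε)| ≤ C * ε ^ m := by
  have hc := tipSlope_pos hm
  have hμ := muBar_pos hm
  have hK := stressBound_pos (m := m)
  have hA := tipError_pos hm
  have hD := SolitaryWave.slopeError_pos hm
  set K₁ := 4 * stressBound m / tipSlope m ^ 2 with hK₁
  set L := (tipSlope m / 2) ^ (-(m + 1)) with hL
  set D := SolitaryWave.slopeError m with hDdef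
  set b := 1 / (12 * muBar m) with hb
  have hb0 : 0 < b := by positivity
  have hK₁0 : 0 < K₁ := by positivity
  have hL0 : 0 < L := by positivity
  have c1 : 0 ≤ 2 * D / (muBar m * b ^ 3) := by positivity
  have c2 : 0 ≤ (muBar m + L) * D / muBar m := by positivity
  refine ⟨K₁ + 2 * D / (muBar m * b ^ 3) + D + 2 * tipError m + (muBar m + L) * D / muBar m,
    by positivity, ?_⟩
  set C := K₁ + 2 * D / (muBar m * b ^ 3) + D + 2 * tipError m + (muBar m + L) * D / muBar m
    with hC
  filter_upwards [self_mem_nhdsWithin, eventually_mul_le (C := 1) (by norm_num : (0 : ℝ) < 1 / 12),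
    eventually_mul_le (C := 1 + 2 * stressBound m) hc,
    eventually_mul_le (C := tipError m) (by norm_num : (0 : ℝ) < 1 / 12),
    eventually_mul_le (C := K₁) (by norm_num : (0 : ℝ) < 1 / 2)]
    with ε hε0 hε1 hε2 hε3 hε4
  rw [one_mul] at hε1
  have hε0 : 0 < ε := hε0
  refine ⟨hε1, fun δ V R σ h hε => ?_⟩
  have hEm : 0 < ε ^ m := rpow_pos_of_pos hε0 _
  have hEle : ε ^ m ≤ ε := by
    calc ε ^ m ≤ ε ^ (1 : ℝ) := rpow_le_rpow_of_exponent_ge hε0 (by linarith) hm.le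
      _ = ε := rpow_one _
  obtain ⟨X, hX1, hXσ, hXε, hcore⟩ := h.exists_scale hm hS hε hε1 hε2
  have hX0 : 0 < X := by linarith
  obtain ⟨hR, hR'⟩ := hcore (1 / 2) ⟨by norm_num, le_rfl⟩
  rw [show 2 * X * (1 / 2) = X by ring] at hR hR'
  have hXε' := h.scale_ge hm hS hε hε1 hε3 hX1 hR
  obtain ⟨hP, hRP⟩ := h.abs_slopeHat_sub_le hm hS hε hε1 hX1 hXσ hXε hXε' hR hR'
  have hfar := h.farForce_le hm hε hX0 hXσ hXε
  have hμh := muHat_pos hm hS hε0 hε1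
  have hdiv := div_muHat hm hS hε0 hε1
  have hPge := slopeHat_ge hm hS hε0 hε1
  set P := slopeHat S ε with hPdef
  -- `2 X = 1 / μ` and `Y = 1 / μ̂` are the inverses of the true and the predicted length scale
  set Y := 1 / muHat m S ε with hY
  have hY0 : 0 < Y := by positivity
  have hYε : Y * ε = P / muBar m := by rw [← hdiv, hY]; ring
  have hXY : |2 * X - Y| * ε ≤ D / muBar m * ε ^ m := by
    have e : |2 * X - Y| * ε = |P - 2 * X * ε * muBar m| / muBar m := by
      rw [eq_div_iff hμ.ne', ← abs_of_pos hε0, ← abs_mul, ← abs_of_pos hμ, ← abs_mul,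
        abs_of_pos hε0, abs_of_pos hμ, abs_sub_comm P]
      congr 1
      rw [sub_mul, hYε]; field_simp
    rw [e, div_mul_eq_mul_div]
    gcongr
  have hEC : ∀ c, c ≤ C → c * ε ^ m ≤ C * ε ^ m := fun c hc =>
    mul_le_mul_of_nonneg_right hc hEm.le
  have hpos : ∀ y ∈ Icc (0 : ℝ) (1 / 2),
        |R y - (1 - ε - ε * S (y / muHat m S ε))| ≤ C * ε ^ m ∧
        |deriv R y + ε / muHat m S ε * deriv S (y / muHat m S ε)| ≤ C * ε ^ m := by
    intro y hy
    obtain ⟨h1, h2⟩ := hcore y hy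
    have hYy : y / muHat m S ε = Y * y := by rw [hY]; ring
    have hYε' : ε / muHat m S ε = Y * ε := by rw [hY]; ring
    rw [hYy, hYε']
    constructor
    · have h3 := hS.abs_sub_le hm (a := 2 * X * y) (b := Y * y)
        (mul_nonneg (by linarith) hy.1) (mul_nonneg hY0.le hy.1)
      have h4 : ε * |S (2 * X * y) - S (Y * y)| ≤ D * ε ^ m := by
        rw [← sub_mul, abs_mul, abs_of_nonneg hy.1] at h3
        calc ε * |S (2 * X * y) - S (Y * y)| ≤ ε * (muBar m * (|2 * X - Y| * y)) := by gcongr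
          _ ≤ ε * (muBar m * (|2 * X - Y| * 1)) := by gcongr; linarith [hy.2]
          _ = muBar m * (|2 * X - Y| * ε) := by ring
          _ ≤ muBar m * (D / muBar m * ε ^ m) := by gcongr
          _ = D * ε ^ m := by field_simp
      have e : R y - (1 - ε - ε * S (Y * y)) =
          (R y - (1 - ε - ε * S (2 * X * y))) - ε * (S (2 * X * y) - S (Y * y)) := by ring
      rw [e]
      refine (abs_sub _ _).trans ?_
      rw [abs_mul, abs_of_pos hε0]
      refine (add_le_add h1 h4).trans ?_
      rw [← add_mul]
      exact hEC _ (by rw [hC]; linarith)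
    · have h3 := hS.abs_mul_deriv_sub_le hm (a := 2 * X) (b := Y) (by linarith) hY0.le hy.1
      have h4 : ε * |2 * X * deriv S (2 * X * y) - Y * deriv S (Y * y)| ≤
          (muBar m + L) * D / muBar m * ε ^ m := by
        calc _ ≤ ε * ((muBar m + L) * |2 * X - Y|) := by gcongr
          _ = (muBar m + L) * (|2 * X - Y| * ε) := by ring
          _ ≤ (muBar m + L) * (D / muBar m * ε ^ m) := by gcongr
          _ = _ := by ring
      have e : deriv R y + Y * ε * deriv S (Y * y) =
          (deriv R y + 2 * X * ε * deriv S (2 * X * y)) -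
          ε * (2 * X * deriv S (2 * X * y) - Y * deriv S (Y * y)) := by ring
      rw [e]
      refine (abs_sub _ _).trans ?_
      rw [abs_mul, abs_of_pos hε0]
      refine (add_le_add h2 h4).trans ?_
      rw [← add_mul]
      exact hEC _ (by rw [hC]; linarith)
  refine ⟨hfar.trans (hEC _ (by rw [hC]; linarith)), ?_, ?_,
    hRP.trans (hEC _ (by rw [hC]; linarith)), fun y hy => ?_⟩
  · refine hfar.trans (le_trans ?_ hε4)
    gcongr
  · have hE2 : ε ^ (-m - 2) * (ε ^ m * ε ^ 2) = 1 := by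
      rw [show ε ^ 2 = ε ^ (2 : ℝ) by norm_num, ← rpow_add hε0, ← rpow_add hε0]
      simp
    have hE2' : ε ^ (m + 2) = ε ^ m * ε ^ 2 := by
      rw [rpow_add hε0]; norm_num
    set a := 2 * X * ε with ha
    set d := Y * ε with hd
    have ha0 : b ≤ a := by rw [ha]; linarith
    have hd0 : b ≤ d := by
      rw [hYε, hb, div_le_div_iff₀ (by positivity) hμ]
      nlinarith
    have hda : |d - a| ≤ D / muBar m * ε ^ m := by
      rw [abs_sub_comm, ha, hd, ← sub_mul, abs_mul, abs_of_pos hε0]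
      exact hXY
    have ha0' : 0 < a := hb0.trans_le ha0
    have hd0' : 0 < d := hb0.trans_le hd0
    have hσa : σ = (ε ^ m)⁻¹ * (1 / a ^ 2) := by
      rw [hE2'] at hXσ
      rw [ha]
      field_simp
      linarith
    have hσd : sigmaHat m S ε = (ε ^ m)⁻¹ * (1 / d ^ 2) := by
      have h5 : ε ^ (-m - 2) = (ε ^ m)⁻¹ * (ε ^ 2)⁻¹ := by
        rw [← mul_inv]; exact eq_inv_of_mul_eq_one_left hE2
      rw [sigmaHat, h5, hd, hY]
      field_simp
    have h6 : |1 / a ^ 2 - 1 / d ^ 2| ≤ 2 / b ^ 3 * |d - a| := by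
      have e : 1 / a ^ 2 - 1 / d ^ 2 = (1 / (a ^ 2 * d) + 1 / (a * d ^ 2)) * (d - a) := by
        field_simp; ring
      rw [e, abs_mul, abs_of_pos (by positivity)]
      gcongr
      have h7 : 1 / (a ^ 2 * d) ≤ 1 / (b ^ 2 * b) := by gcongr
      have h8 : 1 / (a * d ^ 2) ≤ 1 / (b * b ^ 2) := by gcongr
      calc _ ≤ _ := add_le_add h7 h8
        _ = _ := by field_simp; norm_num
    rw [hσa, hσd, ← mul_sub, abs_mul, abs_of_pos (by positivity)]
    calc _ ≤ (ε ^ m)⁻¹ * (2 / b ^ 3 * (D / muBar m * ε ^ m)) := by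
          gcongr
          exact h6.trans (by gcongr)
      _ = 2 * D / (muBar m * b ^ 3) := by field_simp
      _ ≤ C := by rw [hC]; linarith
  · rcases le_total 0 y with hy0 | hy0
    · exact hpos y ⟨hy0, hy.2⟩
    · obtain ⟨h1, h2⟩ := hpos (-y) ⟨by linarith, by linarith [hy.1]⟩
      rw [h.even_R, neg_div, hS.even hm] at h1
      rw [h.deriv_R_odd, neg_div, hS.deriv_odd hm, mul_neg, ← neg_add, abs_neg] at h2
      exact ⟨h1, h2⟩

/-- Pointwise form of the approximation result, with an integrable weight. -/
lemma exists_pointwise_approximation (hm : 1 < m) {S : ℝ → ℝ} (hS : IsTipProfile m S) :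
    ∃ C, 0 < C ∧ ∀ᶠ ε in 𝓝[>] (0 : ℝ), ∀ (δ : ℝ) (V R : ℝ → ℝ) (σ : ℝ),
      SolitaryWave m δ V R σ → R 0 = 1 - ε →
      |σ - sigmaHat m S ε| ≤ C ∧
      (∀ x, |R x - RHat m S ε x| ≤ C * ε ^ m * (1 + x ^ 2)⁻¹) ∧
      (∀ x, |V x - VHat m S ε x| ≤ C * ε ^ m * (1 + x ^ 2)⁻¹) := by
  obtain ⟨C, hC, hev⟩ := exists_core_approximation hm hS
  refine ⟨30 * C, by positivity, ?_⟩
  filter_upwards [hev, self_mem_nhdsWithin] with ε ⟨hε1, hall⟩ hε0 δ V R σ h hε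
  have hε0 : 0 < ε := hε0
  obtain ⟨hfar, hfar2, hσ, hRP, hcore⟩ := hall δ V R σ h hε
  have hεR : 1 - R 0 ≤ 1 / 12 := by linarith
  have hEm : 0 < ε ^ m := rpow_pos_of_pos hε0 _
  have hCE : 0 < C * ε ^ m := by positivity
  have hfp := h.farForce_pos
  have hdiv := div_muHat hm hS hε0 hε1
  have hμ := muBar_pos hm
  have hPid : ε / muHat m S ε * muBar m = slopeHat S ε := by rw [hdiv]; field_simp
  have hweight : ∀ x : ℝ, |x| < 3 / 2 → ∀ t, t ≤ 7 * (C * ε ^ m) →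
      t ≤ 30 * C * ε ^ m * (1 + x ^ 2)⁻¹ := fun x hx t ht => by
    rw [← div_eq_mul_inv, le_div_iff₀ (by positivity)]
    have h1 : x ^ 2 ≤ (3 / 2) ^ 2 := by rw [← sq_abs]; gcongr
    have h2 : 0 ≤ x ^ 2 := sq_nonneg x
    nlinarith
  have hRpos : ∀ x, 0 ≤ x → |R x - RHat m S ε x| ≤ 30 * C * ε ^ m * (1 + x ^ 2)⁻¹ := by
    intro x hx
    by_cases h1 : x < 1 / 2
    · refine hweight x (by rw [abs_of_nonneg hx]; linarith) _ ?_
      rw [RHat, abs_of_nonneg hx, if_pos h1]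
      exact (hcore x ⟨by linarith, h1.le⟩).1.trans (by linarith)
    by_cases h2 : x < 3 / 2
    · refine hweight x (by rwa [abs_of_nonneg hx]) _ ?_
      rw [RHat, abs_of_nonneg hx, if_neg h1, if_pos h2]
      obtain ⟨y, rfl⟩ : ∃ y, x = 1 + y := ⟨x - 1, by ring⟩
      have hy : y ∈ Icc (-1 / 2 : ℝ) (1 / 2) := ⟨by linarith, by linarith⟩
      have k1 := abs_le.1 ((h.abs_R_foot_le hm hεR hy).trans
        (mul_le_mul_of_nonneg_left hfar (by norm_num)))
      have k2 := abs_le.1 (hcore y hy).1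
      have e : ε * footProfile m S ((1 - (1 + y)) / muHat m S ε) =
          1 / 2 * (ε * S (y / muHat m S ε) - slopeHat S ε * y + ε * kappaBar S) := by
        rw [footProfile, show (1 - (1 + y)) / muHat m S ε = -(y / muHat m S ε) by ring,
          hS.even hm, ← hPid]
        ring
      have k3 : |(R (1 / 2) - slopeHat S ε / 2) * (1 - y)| ≤ C * ε ^ m * (3 / 2) := by
        rw [abs_mul, abs_of_nonneg (show 0 ≤ 1 - y by linarith [hy.2])]
        exact mul_le_mul hRP (by linarith [hy.1]) (by linarith [hy.2]) hCE.le
      have k3 := abs_le.1 k3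
      have e2 : R (1 + y) -
          1 / 2 * (ε * S (y / muHat m S ε) - slopeHat S ε * y + ε * kappaBar S) =
          (R (1 + y) - (R (1 / 2) * (1 - y) - R y / 2)) +
          (R (1 / 2) - slopeHat S ε / 2) * (1 - y)
          - 1 / 2 * (R y - (1 - ε - ε * S (y / muHat m S ε))) := by
        rw [slopeHat]; ring
      rw [e, e2, abs_le]
      constructor <;> linarith [k1.1, k1.2, k2.1, k2.2, k3.1, k3.2]
    · rw [RHat, abs_of_nonneg hx, if_neg h1, if_neg h2, sub_zero, abs_of_nonneg (h.nonneg_R x)]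
      refine (h.R_tail hm hεR hfar2 (by rw [abs_of_nonneg hx]; linarith)).trans ?_
      gcongr ?_ * _
      linarith
  have hVpos : ∀ x, 0 ≤ x → |V x - VHat m S ε x| ≤ 30 * C * ε ^ m * (1 + x ^ 2)⁻¹ := by
    intro x hx
    by_cases h1 : x < 1
    · refine hweight x (by rw [abs_of_nonneg hx]; linarith) _ ?_
      rw [VHat, abs_of_nonneg hx, if_pos h1]
      obtain ⟨y, rfl⟩ : ∃ y, x = 1 / 2 + y := ⟨x - 1 / 2, by ring⟩
      have hy : y ∈ Icc (-1 / 2 : ℝ) (1 / 2) := ⟨by linarith, by linarith⟩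
      have k1 := abs_le.1 ((h.abs_V_transition_le hm hεR hy).trans
        (mul_le_mul_of_nonneg_left hfar (by norm_num)))
      have k2 := abs_le.1 (hcore y hy).2
      have k3 := abs_le.1 hRP
      have e : ε / muHat m S ε * transitionProfile m S ((1 / 2 - (1 / 2 + y)) / muHat m S ε) =
          1 / 2 * (slopeHat S ε - ε / muHat m S ε * deriv S (y / muHat m S ε)) := by
        rw [transitionProfile,
          show (1 / 2 - (1 / 2 + y)) / muHat m S ε = -(y / muHat m S ε) by ring,
          hS.deriv_odd hm, ← hPid]
        ring
      rw [e, abs_le]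
      constructor <;> linarith [k1.1, k1.2, k2.1, k2.2, k3.1, k3.2]
    · rw [VHat, abs_of_nonneg hx, if_neg h1, mul_zero, sub_zero, abs_of_nonneg (h.nonneg_V x)]
      refine (h.V_tail hm hεR hfar2 (by rw [abs_of_nonneg hx]; linarith)).trans ?_
      gcongr ?_ * _
      linarith
  refine ⟨hσ.trans (by linarith), fun x => ?_, fun x => ?_⟩
  · rcases le_total 0 x with hx | hx
    · exact hRpos x hx
    · have := hRpos (-x) (by linarith)
      rwa [h.even_R, neg_sq, RHat, abs_neg, ← RHat] at this
  · rcases le_total 0 x with hx | hx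
    · exact hVpos x hx
    · have := hVpos (-x) (by linarith)
      rwa [h.even_V, neg_sq, VHat, abs_neg, ← VHat] at this

/-! ### The amplitude and the norm deficit -/

lemma intervalIntegral_le_of_le_deriv {f g g' : ℝ → ℝ} {a b : ℝ} (hab : a ≤ b)
    (hf : Continuous f) (hg : ∀ x ∈ Icc a b, HasDerivAt g (g' x) x)
    (h : ∀ x ∈ Icc a b, f x ≤ g' x) : ∫ x in a..b, f x ≤ g b - g a := by
  have := sub_le_sub_of_hasDerivAt_le (f := fun x => ∫ t in a..x, f t) hab
    (fun x _ => intervalIntegral.integral_hasDerivAt_right (hf.intervalIntegrable _ _)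
      (hf.stronglyMeasurableAtFilter _ _) hf.continuousAt) hg h
  simpa using this

lemma eventually_mul_rpow_le (hm : 1 < m) {C a : ℝ} (ha : 0 < a) :
    ∀ᶠ ε : ℝ in 𝓝[>] 0, C * ε ^ (m - 1) ≤ a := by
  have h : Tendsto (fun ε : ℝ => C * ε ^ (m - 1)) (𝓝[>] 0) (𝓝 0) := by
    have h1 := ((continuousAt_rpow_const (0 : ℝ) (m - 1)
      (Or.inr (by linarith))).tendsto.const_mul C).mono_left
        (nhdsWithin_le_nhds (s := Ioi 0))
    rwa [zero_rpow (by linarith), mul_zero] at h1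
  exact h.eventually (ge_mem_nhds ha)

/-- The velocity of a wave is determined, up to `η`, by the function
`q(t) = (ε / μ̂) (μ̄ - S'(t / μ̂))` on both sides of `x = 1 / 2`. This lemma turns that into an upper
bound for the energy: on `[0, 1 / 2]` the variance identity for the mean `1 - ε` of `V` is used,
so that only `∫ q²` enters, and `q²` is dominated by a derivative. -/
lemma SolitaryWave.norm_sq_le (hm : 1 < m) {S : ℝ → ℝ} (hS : IsTipProfile m S) {δ σ ε η : ℝ}
    {V R : ℝ → ℝ} (h : SolitaryWave m δ V R σ) (hε : R 0 = 1 - ε) (hε1 : ε ≤ 1 / 12)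
    (hη : 0 ≤ η) (hV : ∀ x, |V x - VHat m S ε x| ≤ η * (1 + x ^ 2)⁻¹) :
    (1 - δ) ^ 2 ≤ (1 - ε) ^ 2 + 2 / m * (ε * slopeHat S ε) +
      2 * ((1 + kappaBar S) * η + (ε * kappaBar S + η) ^ 2) + 4 * η ^ 2 := by
  have hε0 := h.amplitude_pos hε
  have hc := h.continuous_V
  have hm0 : 0 < m := by linarith
  have hκ := hS.kappaBar_nonneg hm
  have hμ := muBar_pos hm
  have hμh := muHat_pos hm hS hε0 hε1
  have hdiv := div_muHat hm hS hε0 hε1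
  have hPid : ε / muHat m S ε * muBar m = slopeHat S ε := by rw [hdiv]; field_simp
  have hP := slopeHat_le hm hS hε0 hε1
  set P := slopeHat S ε with hPdef
  set ν := muHat m S ε with hν
  set κ := kappaBar S with hκdef
  set err := (1 + κ) * η + (ε * κ + η) ^ 2 with herr
  set q : ℝ → ℝ := fun t => ε / ν * (muBar m - deriv S (t / ν)) with hq
  have hq0 : ∀ t, 0 ≤ q t := fun t =>
    mul_nonneg (by positivity) (by linarith [hS.deriv_le_muBar hm (t / ν)])
  have hqP : ∀ t, 0 ≤ t → q t ≤ 1 + κ := fun t ht => by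
    have h1 := hS.deriv_nonneg hm (x := t / ν) (by positivity)
    refine le_trans ?_ hP
    rw [← hPid]
    simp only [hq]
    gcongr
    linarith
  have hqsq : ∀ t, 0 ≤ t → q t ^ 2 / 4 ≤ (ε / ν) ^ 2 / (2 * m) * tipForce m (S (t / ν)) :=
    fun t ht => by
      have h1 := hS.sq_muBar_sub_deriv_le hm (t / ν) (by positivity)
      calc q t ^ 2 / 4 = (ε / ν) ^ 2 * (muBar m - deriv S (t / ν)) ^ 2 / 4 := by
            simp only [hq]; ring
        _ ≤ (ε / ν) ^ 2 * (2 / m * tipForce m (S (t / ν))) / 4 := by gcongr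
        _ = _ := by field_simp; ring
  have hVη : ∀ x, |V x - VHat m S ε x| ≤ η := fun x => (hV x).trans <| by
    refine mul_le_of_le_one_right hη ?_
    exact inv_le_one_of_one_le₀ (by nlinarith [sq_nonneg x])
  set Q : ℝ → ℝ := fun t => ε ^ 2 / ν / (2 * m) * deriv S (t / ν) + err * t with hQ
  have hQd : ∀ t, HasDerivAt Q ((ε / ν) ^ 2 / (2 * m) * tipForce m (S (t / ν)) + err) t :=
    fun t => by
      have h0 : HasDerivAt (fun t => t / ν) (1 / ν) t := (hasDerivAt_id t).div_const ν
      have h1 : HasDerivAt (fun t => deriv S (t / ν)) (tipForce m (S (t / ν)) * (1 / ν)) t :=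
        HasDerivAt.comp (h₂ := deriv S) (h := fun t => t / ν) t (hS.hasDerivAt_deriv (t / ν)) h0
      convert! (h1.const_mul (ε ^ 2 / ν / (2 * m))).fun_add ((hasDerivAt_id t).const_mul err)
        using 1
      field_simp
  have hQle : Q (1 / 2) - Q 0 ≤ ε * P / (2 * m) + err / 2 := by
    have h1 : ε ^ 2 / ν / (2 * m) * deriv S (1 / 2 / ν) ≤ ε ^ 2 / ν / (2 * m) * muBar m := by
      gcongr; exact hS.deriv_le_muBar hm _
    have h2 : ε ^ 2 / ν / (2 * m) * muBar m = ε * P / (2 * m) := by rw [← hPid]; ring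
    simp only [hQ, zero_div, hS.init_deriv]
    linarith
  have hright : ∫ x in (1 / 2 : ℝ)..1, V x ^ 2 ≤ ε * P / (2 * m) + err / 2 := by
    have h1 := intervalIntegral_le_of_le_deriv (f := fun x => V x ^ 2)
      (g := fun x => Q (x - 1 / 2)) (a := 1 / 2) (b := 1) (by norm_num) (hc.pow 2)
      (fun x _ => (hQd (x - 1 / 2)).comp_sub_const x (1 / 2)) fun x hx => by
        have hx0 : 0 ≤ x - 1 / 2 := by linarith [hx.1]
        have h2 : V x ≤ q (x - 1 / 2) / 2 + η := by
          have h3 := (abs_le.1 (hVη x)).2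
          have h4 : VHat m S ε x ≤ q (x - 1 / 2) / 2 := by
            rw [VHat, abs_of_nonneg (by linarith [hx.1])]
            split_ifs
            · rw [transitionProfile,
                show (1 / 2 - x) / muHat m S ε = -((x - 1 / 2) / ν) by rw [hν]; ring,
                hS.deriv_odd hm]
              simp only [hq]
              apply le_of_eq; ring
            · rw [mul_zero]; linarith [hq0 (x - 1 / 2)]
          linarith
        have h5 := hqsq _ hx0
        have h6 := hq0 (x - 1 / 2)
        have h7 : q (x - 1 / 2) * η ≤ (1 + κ) * η := by gcongr; exact hqP _ hx0
        have h8 : η ^ 2 ≤ (ε * κ + η) ^ 2 := by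
          have : 0 ≤ ε * κ := by positivity
          gcongr; linarith
        calc V x ^ 2 ≤ (q (x - 1 / 2) / 2 + η) ^ 2 := pow_le_pow_left₀ (h.nonneg_V x) h2 2
          _ = q (x - 1 / 2) ^ 2 / 4 + q (x - 1 / 2) * η + η ^ 2 := by ring
          _ ≤ _ := by rw [herr]; linarith
    norm_num at h1
    norm_num at hQle ⊢
    linarith
  have hleft : ∫ x in (0 : ℝ)..(1 / 2), (V x - (1 - ε)) ^ 2 ≤ ε * P / (2 * m) + err / 2 := by
    have h1 := intervalIntegral_le_of_le_deriv (f := fun x => (V x - (1 - ε)) ^ 2)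
      (g := fun x => -Q (1 / 2 - x)) (a := 0) (b := 1 / 2) (by norm_num)
      ((hc.sub continuous_const).pow 2)
      (fun x _ => by simpa using ((hQd (1 / 2 - x)).comp_const_sub (1 / 2) x).fun_neg)
      fun x hx => by
        have hx0 : 0 ≤ 1 / 2 - x := by linarith [hx.2]
        have h3 := abs_le.1 (hVη x)
        have h4 : VHat m S ε x = P - q (1 / 2 - x) / 2 := by
          rw [VHat, abs_of_nonneg hx.1, if_pos (by linarith [hx.2]), transitionProfile, ← hPid]
          simp only [hq]
          ring
        have h9 : P - (1 - ε) = ε * κ := by rw [hPdef, slopeHat]; ring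
        have h5 := hqsq _ hx0
        have h6 := hq0 (1 / 2 - x)
        have h7 : q (1 / 2 - x) * η ≤ (1 + κ) * η := by gcongr; exact hqP _ hx0
        have hεκ : 0 ≤ ε * κ := by positivity
        obtain ⟨r, hr⟩ : ∃ r, r = V x - VHat m S ε x := ⟨_, rfl⟩
        rw [← hr] at h3
        have h10 : V x - (1 - ε) = (ε * κ + r) - q (1 / 2 - x) / 2 := by rw [hr, h4]; linarith
        have h11 : (ε * κ + r) ^ 2 ≤ (ε * κ + η) ^ 2 := by
          refine sq_le_sq' ?_ ?_ <;> linarith [h3.1, h3.2]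
        have h12 : -(q (1 / 2 - x) * (ε * κ + r)) ≤ q (1 / 2 - x) * η := by
          rw [← mul_neg]
          gcongr
          linarith [h3.1]
        rw [h10]
        calc _ = q (1 / 2 - x) ^ 2 / 4 + -(q (1 / 2 - x) * (ε * κ + r)) + (ε * κ + r) ^ 2 := by ring
          _ ≤ _ := by rw [herr]; linarith
    norm_num at h1
    norm_num at hQle ⊢
    linarith
  have hvar : ∫ x in (0 : ℝ)..(1 / 2), (V x - (1 - ε)) ^ 2 =
      (∫ x in (0 : ℝ)..(1 / 2), V x ^ 2) - (1 - ε) ^ 2 / 2 := by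
    have e : ∀ x, (V x - (1 - ε)) ^ 2 = V x ^ 2 - 2 * (1 - ε) * V x + (1 - ε) ^ 2 := fun x => by
      ring
    simp only [e]
    rw [intervalIntegral.integral_add, intervalIntegral.integral_sub,
      intervalIntegral.integral_const_mul, intervalIntegral.integral_const, h.integral_half_core,
      hε]
    · simp only [smul_eq_mul]; ring
    all_goals exact Continuous.intervalIntegrable (by fun_prop) _ _
  have hhalf : ∫ x in (0 : ℝ)..1, V x ^ 2 ≤ (1 - ε) ^ 2 / 2 + ε * P / m + err := by
    have h1 := intervalIntegral.integral_add_adjacent_intervals (μ := volume)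
      ((hc.pow 2).intervalIntegrable 0 (1 / 2)) ((hc.pow 2).intervalIntegrable (1 / 2) 1)
    simp only [Pi.pow_apply] at h1
    have : ε * P / m = ε * P / (2 * m) + ε * P / (2 * m) := by field_simp; norm_num
    rw [hvar] at hleft
    linarith
  have hsymm : ∫ x in (-1 : ℝ)..1, V x ^ 2 = 2 * ∫ x in (0 : ℝ)..1, V x ^ 2 := by
    have h1 : ∫ x in (0 : ℝ)..1, V (-x) ^ 2 = ∫ x in (-1 : ℝ)..(-0), V x ^ 2 :=
      intervalIntegral.integral_comp_neg fun x => V x ^ 2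
    simp only [h.even_V, neg_zero] at h1
    have h2 := intervalIntegral.integral_add_adjacent_intervals (μ := volume)
      ((hc.pow 2).intervalIntegrable (-1) 0) ((hc.pow 2).intervalIntegrable 0 1)
    simp only [Pi.pow_apply] at h2
    rw [← h2, ← h1]; ring
  have htail : (1 - δ) ^ 2 ≤ (∫ x in (-1 : ℝ)..1, V x ^ 2) + η ^ 2 * π := by
    rw [← h.integral_V_sq, intervalIntegral.integral_of_le (by norm_num),
      ← integral_indicator measurableSet_Ioc, ← integral_univ_inv_one_add_sq,
      ← integral_const_mul, ← integral_add
        (h.integrable_V_sq.indicator measurableSet_Ioc) (integrable_inv_one_add_sq.const_mul _)]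
    refine integral_mono h.integrable_V_sq ((h.integrable_V_sq.indicator measurableSet_Ioc).add
      (integrable_inv_one_add_sq.const_mul _)) fun x => ?_
    have hw : 0 < (1 + x ^ 2)⁻¹ := by positivity
    by_cases hx : x ∈ Ioc (-1 : ℝ) 1
    · simp only [indicator_of_mem hx]
      have : 0 ≤ η ^ 2 * (1 + x ^ 2)⁻¹ := by positivity
      linarith
    · simp only [indicator_of_notMem hx, zero_add]
      have hx1 : ¬ |x| < 1 := fun h' => hx ⟨(abs_lt.1 h').1, (abs_lt.1 h').2.le⟩
      have h1 := hV x
      rw [VHat, if_neg hx1, mul_zero, sub_zero, abs_of_nonneg (h.nonneg_V x)] at h1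
      have hw1 : (1 + x ^ 2)⁻¹ ≤ 1 := inv_le_one_of_one_le₀ (by nlinarith [sq_nonneg x])
      calc V x ^ 2 ≤ (η * (1 + x ^ 2)⁻¹) ^ 2 := pow_le_pow_left₀ (h.nonneg_V x) h1 2
        _ = η ^ 2 * ((1 + x ^ 2)⁻¹ * (1 + x ^ 2)⁻¹) := by ring
        _ ≤ η ^ 2 * ((1 + x ^ 2)⁻¹ * 1) := by gcongr
        _ = _ := by ring
  have hπ : η ^ 2 * π ≤ 4 * η ^ 2 := by nlinarith [pi_le_four, sq_nonneg η]
  have hfin : 2 / m * (ε * P) = 2 * (ε * P / m) := by ring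
  rw [hfin]
  linarith

/-- The amplitude parameter is bounded by a multiple of the norm deficit. -/
lemma exists_amplitude_le (hm : 1 < m) {S : ℝ → ℝ} (hS : IsTipProfile m S) :
    ∃ C, 0 < C ∧ ∀ᶠ ε in 𝓝[>] (0 : ℝ), ∀ (δ : ℝ) (V R : ℝ → ℝ) (σ : ℝ),
      SolitaryWave m δ V R σ → R 0 = 1 - ε → ε ≤ C * δ := by
  obtain ⟨C, hC, hev⟩ := exists_pointwise_approximation hm hS
  have hm0 : 0 < m := by linarith
  have hκ := hS.kappaBar_nonneg hm
  set a := 1 - 1 / m with ha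
  have ha0 : 0 < a := by
    rw [ha, sub_pos, div_lt_one hm0]; exact hm
  refine ⟨2 / a, by positivity, ?_⟩
  filter_upwards [hev, self_mem_nhdsWithin,
    eventually_mul_le (C := 1) (by norm_num : (0 : ℝ) < 1 / 12),
    eventually_mul_le (C := 1 + 2 / m * kappaBar S + 2 * (kappaBar S + C) ^ 2 + 4 * C ^ 2)
      (half_pos ha0),
    eventually_mul_rpow_le hm (C := 2 * (1 + kappaBar S) * C) (half_pos ha0)]
    with ε hall hε0 hε1 h1 h2 δ V R σ h hε
  have hε0 : 0 < ε := hε0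
  rw [one_mul] at hε1
  obtain ⟨-, -, hV⟩ := hall δ V R σ h hε
  have hs : ε ^ m = ε * ε ^ (m - 1) := by
    rw [rpow_sub hε0, rpow_one]; field_simp
  have hs1 : ε ^ (m - 1) ≤ 1 := rpow_le_one hε0.le (by linarith) (by linarith)
  have hs0 : 0 < ε ^ (m - 1) := rpow_pos_of_pos hε0 _
  have hη : C * ε ^ m ≤ C * ε := by rw [hs]; gcongr; exact mul_le_of_le_one_right hε0.le hs1
  have hη0 : 0 ≤ C * ε ^ m := by rw [hs]; positivity
  have key := h.norm_sq_le hm hS hε hε1 hη0 hV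
  set κ := kappaBar S with hκdef
  set η := C * ε ^ m with hηdef
  have k1 : (1 + κ) * η = ε * ((1 + κ) * C * ε ^ (m - 1)) := by rw [hηdef, hs]; ring
  have k2 : (ε * κ + η) ^ 2 ≤ ε ^ 2 * (κ + C) ^ 2 := by
    rw [← mul_pow]
    have : 0 ≤ ε * κ := by positivity
    gcongr
    linarith
  have k3 : η ^ 2 ≤ ε ^ 2 * C ^ 2 := by
    rw [← mul_pow, mul_comm ε]; gcongr
  have k4 : ε * slopeHat S ε ≤ ε * (1 + ε * κ) := by
    rw [slopeHat]; gcongr; linarith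
  have k5 := mul_le_mul_of_nonneg_left k4 (show 0 ≤ 2 / m by positivity)
  have k6 := mul_le_mul_of_nonneg_left h1 hε0.le
  have k7 := mul_le_mul_of_nonneg_left h2 hε0.le
  have k8 : ε * a ≤ 2 * δ := by
    have e : 2 / m = 2 - 2 * a := by rw [ha]; ring
    rw [e] at k5 k6 key
    nlinarith [sq_nonneg δ]
  rw [div_mul_eq_mul_div, le_div_iff₀ ha0]
  exact k8

/-! ### The high-energy limit -/

lemma potential_zero : potential m 0 = 0 := by simp [potential]

lemma potential_nonneg (hm : 1 < m) {r : ℝ} (hr : 0 ≤ r) (hr1 : r < 1) : 0 ≤ potential m r := by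
  have := sub_le_sub_of_hasDerivAt_le hr (fun y _ => hasDerivAt_const y (0 : ℝ))
    (fun y hy => hasDerivAt_potential hm (hy.2.trans_lt hr1))
    fun y hy => stress_nonneg hm hy.1 (hy.2.trans_lt hr1)
  rw [potential_zero] at this
  linarith

lemma potential_le (hm : 1 < m) {c r : ℝ} (hc : 0 < c) (hr : 0 ≤ r) (hr1 : r ≤ 1 - c) :
    potential m r ≤ c ^ (-(m + 2)) * r ^ 2 := by
  have h := abs_sub_le_of_hasDerivAt_abs_le (K := c ^ (-(m + 2)) * r) hr
    (fun y hy => hasDerivAt_potential hm (by linarith [hy.2])) fun y hy => by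
      rw [abs_of_nonneg (stress_nonneg hm hy.1 (by linarith [hy.2]))]
      refine (stress_le_rpow_mul hm hc hy.1 (by linarith [hy.2])).trans ?_
      have := rpow_pos_of_pos hc (-(m + 2))
      gcongr
      exact hy.2
  rw [potential_zero, sub_zero, sub_zero] at h
  calc _ ≤ _ := (le_abs_self _).trans h
    _ = _ := by ring

/-- Waves with amplitude bounded away from `1` have bounded potential energy. -/
lemma SolitaryWave.integral_potential_le (hm : 1 < m) {δ σ c : ℝ} {V R : ℝ → ℝ}
    (h : SolitaryWave m δ V R σ) (hc : 0 < c) (hR : R 0 ≤ 1 - c) :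
    ∫ x, potential m (R x) ≤ 3 * c ^ (-(m + 2)) := by
  have hK := rpow_pos_of_pos hc (-(m + 2))
  set g : ℝ → ℝ := fun x => (Icc (-1 / 2 : ℝ) (1 / 2)).indicator (fun _ => (1 : ℝ)) x +
    (V (x - 1 / 2) ^ 2 + V (x + 1 / 2) ^ 2) with hg
  have hi1 : Integrable fun x => (Icc (-1 / 2 : ℝ) (1 / 2)).indicator (fun _ => (1 : ℝ)) x :=
    (integrableOn_const (by simp)).integrable_indicator measurableSet_Icc
  have hi2 : Integrable fun x => V (x - 1 / 2) ^ 2 := h.integrable_V_sq.comp_sub_right (1 / 2)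
  have hi3 : Integrable fun x => V (x + 1 / 2) ^ 2 := h.integrable_V_sq.comp_add_right (1 / 2)
  have hi23 : Integrable fun x => V (x - 1 / 2) ^ 2 + V (x + 1 / 2) ^ 2 := hi2.add hi3
  have hgi : Integrable g := hi1.add hi23
  have hgint : ∫ x, g x ≤ 3 := by
    simp only [hg]
    rw [integral_add hi1 hi23, integral_add hi2 hi3,
      integral_sub_right_eq_self (fun x => V x ^ 2), integral_add_right_eq_self (fun x => V x ^ 2),
      h.integral_V_sq, integral_indicator measurableSet_Icc]
    norm_num
    nlinarith [h.pos, h.lt_one]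
  have hsq : ∀ x, R x ^ 2 ≤ g x := fun x => by
    have h1 := sq_nonneg (V (x - 1 / 2))
    have h2 := sq_nonneg (V (x + 1 / 2))
    have h0 := h.nonneg_R x
    by_cases hx : x ∈ Icc (-1 / 2 : ℝ) (1 / 2)
    · simp only [hg, indicator_of_mem hx]
      nlinarith [h.R_lt_one x]
    · simp only [hg, indicator_of_notMem hx, zero_add]
      rcases le_total 0 x with hx0 | hx0
      · have := pow_le_pow_left₀ h0 (h.R_le_V (x := x) (by
          by_contra hlt; exact hx ⟨by linarith, by linarith⟩)) 2
        linarith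
      · have h3 := h.R_le_V (x := -x) (by
          by_contra hlt; exact hx ⟨by linarith, by linarith⟩)
        rw [h.even_R, show -x - 1 / 2 = -(x + 1 / 2) by ring, h.even_V] at h3
        have := pow_le_pow_left₀ h0 h3 2
        linarith
  calc ∫ x, potential m (R x) ≤ ∫ x, c ^ (-(m + 2)) * g x := by
        refine integral_mono_of_nonneg
          (Eventually.of_forall fun x => potential_nonneg hm (h.nonneg_R x) (h.R_lt_one x))
          (hgi.const_mul _) (Eventually.of_forall fun x => ?_)
        refine (potential_le hm hc (h.nonneg_R x)
          ((h.R_le_of_abs_le (by simp)).trans hR)).trans ?_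
        exact mul_le_mul_of_nonneg_left (hsq x) hK.le
    _ = c ^ (-(m + 2)) * ∫ x, g x := integral_const_mul _ _
    _ ≤ _ := (mul_le_mul_of_nonneg_left hgint hK.le).trans_eq (mul_comm _ _)

lemma eventually_mem_Ioo : ∀ᶠ δ : ℝ in 𝓝[>] 0, δ ∈ Ioo (0 : ℝ) 1 :=
  Ioo_mem_nhdsGT zero_lt_one

lemma IsHighEnergyFamily.tendsto_amplitude (hm : 1 < m) {V R : ℝ → ℝ → ℝ} {σ : ℝ → ℝ}
    (h : IsHighEnergyFamily m V R σ) : Tendsto (amplitude R) (𝓝[>] 0) (𝓝[>] 0) := by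
  have hpos : ∀ᶠ δ in 𝓝[>] (0 : ℝ), amplitude R δ ∈ Ioi (0 : ℝ) := by
    filter_upwards [eventually_mem_Ioo] with δ hδ
    exact sub_pos.2 (h.range_R δ hδ 0).2
  refine tendsto_nhdsWithin_iff.2 ⟨?_, hpos⟩
  rw [tendsto_order]
  refine ⟨fun a ha => hpos.mono fun δ hδ => ha.trans hδ, fun c hc => ?_⟩
  filter_upwards [eventually_mem_Ioo, h.energy_tendsto.eventually_gt_atTop (3 * c ^ (-(m + 2)))]
    with δ hδ hE
  by_contra hcon
  rw [amplitude, not_lt] at hcon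
  exact absurd ((h.solitaryWave hδ).integral_potential_le hm hc (by linarith)) (not_le.2 hE)

/-! ### Lebesgue norms -/

lemma eLpNorm_inv_one_add_sq_le {q : ℝ≥0∞} (hq : 1 ≤ q) :
    eLpNorm (fun x : ℝ => (1 + x ^ 2)⁻¹) q volume ≤ ENNReal.ofReal 4 := by
  have hw0 : ∀ x : ℝ, 0 ≤ (1 + x ^ 2)⁻¹ := fun x => by positivity
  have hw1 : ∀ x : ℝ, (1 + x ^ 2)⁻¹ ≤ 1 := fun x =>
    inv_le_one_of_one_le₀ (by nlinarith [sq_nonneg x])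
  by_cases hqt : q = ∞
  · subst hqt
    rw [eLpNorm_exponent_top]
    refine (eLpNormEssSup_le_of_ae_bound (C := 1) (Eventually.of_forall fun x => ?_)).trans
      (ENNReal.ofReal_le_ofReal (by norm_num))
    rw [norm_of_nonneg (hw0 x)]
    exact hw1 x
  · have hq1 : 1 ≤ q.toReal := by
      rw [← ENNReal.toReal_one]
      exact (ENNReal.toReal_le_toReal ENNReal.one_ne_top hqt).2 hq
    rw [eLpNorm_eq_lintegral_rpow_enorm_toReal (by positivity) hqt]
    have h1 : ∫⁻ x : ℝ, ‖(1 + x ^ 2)⁻¹‖ₑ ^ q.toReal ≤ ENNReal.ofReal 4 := by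
      calc _ ≤ ∫⁻ x : ℝ, ENNReal.ofReal ((1 + x ^ 2)⁻¹) := by
            refine lintegral_mono fun x => ?_
            rw [Real.enorm_of_nonneg (hw0 x)]
            exact ENNReal.rpow_le_self_of_le_one (ENNReal.ofReal_le_one.2 (hw1 x)) hq1
        _ = ENNReal.ofReal (∫ x : ℝ, (1 + x ^ 2)⁻¹) :=
            (ofReal_integral_eq_lintegral_ofReal integrable_inv_one_add_sq
              (Eventually.of_forall hw0)).symm
        _ ≤ _ := by
            rw [integral_univ_inv_one_add_sq]
            exact ENNReal.ofReal_le_ofReal pi_le_four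
    calc _ ≤ ENNReal.ofReal 4 ^ (1 / q.toReal) := by gcongr
      _ ≤ ENNReal.ofReal 4 ^ (1 : ℝ) := by
          refine ENNReal.rpow_le_rpow_of_exponent_le ?_ ?_
          · rw [← ENNReal.ofReal_one]
            exact ENNReal.ofReal_le_ofReal (by norm_num)
          · rw [div_le_one (by linarith)]; exact hq1
      _ = _ := ENNReal.rpow_one _

lemma eLpNorm_le_of_abs_le_weight {f : ℝ → ℝ} {B : ℝ} (hB : 0 ≤ B)
    (hf : ∀ x, |f x| ≤ B * (1 + x ^ 2)⁻¹) {q : ℝ≥0∞} (hq : 1 ≤ q) :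
    eLpNorm f q volume ≤ ENNReal.ofReal (4 * B) := by
  calc eLpNorm f q volume ≤ eLpNorm (B • fun x : ℝ => (1 + x ^ 2)⁻¹) q volume :=
        eLpNorm_mono_real fun x => hf x
    _ = ENNReal.ofReal B * eLpNorm (fun x : ℝ => (1 + x ^ 2)⁻¹) q volume := by
        rw [eLpNorm_const_smul, Real.enorm_of_nonneg hB]
    _ ≤ ENNReal.ofReal B * ENNReal.ofReal 4 := by
        gcongr; exact eLpNorm_inv_one_add_sq_le hq
    _ = _ := by rw [← ENNReal.ofReal_mul hB, mul_comm]

lemma IsHighEnergyFamily.exists_approxError_le (hm : 1 < m) {S : ℝ → ℝ} (hS : IsTipProfile m S)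
    {V R : ℝ → ℝ → ℝ} {σ : ℝ → ℝ} (h : IsHighEnergyFamily m V R σ) :
    ∃ C, 0 < C ∧ ∀ᶠ δ in 𝓝[>] (0 : ℝ), ∀ q : ℝ≥0∞, 1 ≤ q →
      approxError m S V R σ q δ ≤ ENNReal.ofReal (C * amplitude R δ ^ m) := by
  obtain ⟨C, hC, hev⟩ := exists_pointwise_approximation hm hS
  refine ⟨9 * C, by positivity, ?_⟩
  have ht := h.tendsto_amplitude hm
  filter_upwards [ht.eventually hev, ht.eventually self_mem_nhdsWithin, eventually_mem_Ioo]
    with δ hall hε0 hδ q hq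
  have hε0 : 0 < amplitude R δ := hε0
  obtain ⟨hσ, hR, hV⟩ := hall δ _ _ _ (h.solitaryWave hδ) (by rw [amplitude]; ring)
  set ε := amplitude R δ with hεdef
  have hEm : 0 < ε ^ m := rpow_pos_of_pos hε0 _
  have h1 := eLpNorm_le_of_abs_le_weight (by positivity) hR hq
  have h2 := eLpNorm_le_of_abs_le_weight (by positivity) hV hq
  have h3 : ENNReal.ofReal (ε ^ m * |σ δ - sigmaHat m S ε|) ≤ ENNReal.ofReal (ε ^ m * C) := by
    gcongr
  refine (add_le_add (add_le_add h1 h2) h3).trans_eq ?_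
  rw [← ENNReal.ofReal_add (by positivity) (by positivity),
    ← ENNReal.ofReal_add (by positivity) (by positivity)]
  congr 1
  ring

end FPU

theorem mainTheorem3 (m : ℝ) (hm : 1 < m) :
    (∃! S₀ : ℝ → ℝ, FPU.IsTipProfile m S₀) ∧
    ∀ S₀ : ℝ → ℝ, FPU.IsTipProfile m S₀ →
      IntegrableOn (fun x => x * deriv (deriv S₀) x) (Ioi 0) ∧
      ∀ (V R : ℝ → ℝ → ℝ) (σ : ℝ → ℝ), FPU.IsHighEnergyFamily m V R σ →
        (∃ C : ℝ, ∀ᶠ δ in 𝓝[>] (0 : ℝ), ∀ q : ℝ≥0∞, 1 ≤ q →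
          FPU.approxError m S₀ V R σ q δ ≤ ENNReal.ofReal (C * FPU.amplitude R δ ^ m)) ∧
        (∃ C : ℝ, ∀ᶠ δ in 𝓝[>] (0 : ℝ), ∀ q : ℝ≥0∞, 1 ≤ q →
          FPU.approxError m S₀ V R σ q δ ≤ ENNReal.ofReal (C * δ ^ m)) ∧
        (fun δ => FPU.amplitude R δ ^ m) =Θ[𝓝[>] (0 : ℝ)] (fun δ => δ ^ m) := by
  refine ⟨FPU.existsUnique_isTipProfile hm, fun S hS => ⟨(hS.kappaBar_spec hm).1, ?_⟩⟩
  intro V R σ h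
  have hm0 : 0 ≤ m := by linarith
  have ht := h.tendsto_amplitude hm
  obtain ⟨C, hC, herr⟩ := h.exists_approxError_le hm hS
  obtain ⟨D, hD, hamp⟩ := FPU.exists_amplitude_le hm hS
  have hle : ∀ᶠ δ in 𝓝[>] (0 : ℝ), 0 < FPU.amplitude R δ ∧
      FPU.amplitude R δ ^ m ≤ D ^ m * δ ^ m := by
    filter_upwards [ht.eventually hamp, ht.eventually self_mem_nhdsWithin, FPU.eventually_mem_Ioo]
      with δ hall hε0 hδ
    have hε0 : 0 < FPU.amplitude R δ := hε0
    refine ⟨hε0, ?_⟩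
    rw [← mul_rpow hD.le hδ.1.le]
    exact rpow_le_rpow hε0.le (hall δ _ _ _ (h.solitaryWave hδ) (by rw [FPU.amplitude]; ring)) hm0
  refine ⟨⟨C, herr⟩, ⟨C * D ^ m, ?_⟩, ?_, ?_⟩
  · filter_upwards [herr, hle] with δ h1 h2 q hq
    refine (h1 q hq).trans (ENNReal.ofReal_le_ofReal ?_)
    rw [mul_assoc]
    exact mul_le_mul_of_nonneg_left h2.2 hC.le
  · refine IsBigO.of_bound (D ^ m) ?_
    filter_upwards [hle, FPU.eventually_mem_Ioo] with δ h1 hδ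
    rw [norm_of_nonneg (rpow_nonneg h1.1.le _), norm_of_nonneg (rpow_nonneg hδ.1.le _)]
    exact h1.2
  · refine IsBigO.of_bound 1 ?_
    filter_upwards [hle, FPU.eventually_mem_Ioo] with δ h1 hδ
    rw [norm_of_nonneg (rpow_nonneg h1.1.le _), norm_of_nonneg (rpow_nonneg hδ.1.le _), one_mul]
    refine rpow_le_rpow hδ.1.le ?_ hm0
    rw [FPU.amplitude]
    linarith [(h.solitaryWave hδ).R_zero_le]
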